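/- Let $0<C_1$ and $C_2$ be real numbers. There is a constant $C>0$ depending only on $C_1,C_2$, and for every integer $n>2$ and every $p\in(0,1)$ there is a constant $C'>0$ depending only on $n,p,C_1,C_2$, such that the following holds. Let $\{K_t\}_{t\in[0,t_0]}$ be convex bodies in $\mathbb{R}^n$ with support functions $s(z,t)=\max_{y\in\partial K_t}\langle z,y\rangle$, $z\in\mathbb{S}^{n-1}$. Let $\bar g$ and $\bar\nabla$ be the standard metric and Levi-Civita connection of $\mathbb{S}^{n-1}$, let $\mathfrak{r}_{ij}=\bar\nabla_i\bar\nabla_j s+s\,\bar g_{ij}$ be the matrix of the radii of curvature, and let $\lambda_1\le\dots\le\lambda_{n-1}$ be its eigenvalues with respect to $\bar g$. Assume that $\{K_t\}$ is a smooth, strictly convex solution of the expanding Gauss curvature flow with $\Phi\equiv1$, that is, $s$ is smooth on $\mathbb{S}^{n-1}\times[0,t_0]$, $[\mathfrak{r}_{ij}]$ is positive definite there, and $$\partial_t s=F:=\bigl(\det\nolimits_{\bar g}\mathfrak{r}_{ij}\bigr)^{\frac{p}{n-1}}\quad\text{on }\mathbb{S}^{n-1}\times[0,t_0],$$ and assume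 that $C_1\le F\le C_2$ on $\mathbb{S}^{n-1}\times[0,t_0]$. Then the principal curvatures $\kappa_i=1/\lambda_i$, $1\le i\le n-1$, satisfy on $\mathbb{S}^{n-1}$ $$C'\,t^{\,n-2}\le\kappa_i\ \text{ for all } t\in[0,t_0],\qquad \kappa_i\le\frac{C}{t}\ \text{ for all } t\in(0,t_0].$$ -/

import Mathlib

open scoped ContDiff

noncomputable section

/-- `n`-dimensional Euclidean space. -/
abbrev Euc (n : ℕ) : Type := EuclideanSpace ℝ (Fin n)

/-- The support function `s_K(z) = max_{y ∈ ∂K} ⟨z, y⟩` of a convex body; below it is only evaluated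
at unit vectors `z`, that is, it is used as a function on the unit sphere. -/
def supportFun {n : ℕ} (K : ConvexBody (Euc n)) (z : Euc n) : ℝ :=
  sSup ((fun y : Euc n => inner ℝ z y) '' frontier (K : Set (Euc n)))

/-- The extension, constant along rays from the origin, of the restriction of `f` to the unit
sphere: `x ↦ f (x / |x|)`.  It only depends on the values of `f` on the unit sphere, and a function
on the sphere is smooth exactly if this extension is smooth away from the origin. -/
def radialExt {n : ℕ} {F : Type*} (f : Euc n → F) (x : Euc n) : F :=
  f (‖x‖⁻¹ • x)

/-- The tangent space at `z` of the unit sphere, with the metric induced from the ambient space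
(the standard metric of the sphere). -/
abbrev sphTangent {n : ℕ} (z : Euc n) : Submodule ℝ (Euc n) := (Submodule.span ℝ {z})ᗮ

/-- The gradient on the unit sphere of (the restriction to the sphere of) `f`. -/
def sphGrad {n : ℕ} (f : Euc n → ℝ) (z : Euc n) : Euc n :=
  gradient (radialExt f) z

/-- The Levi-Civita connection of the unit sphere: `v ↦ ∇_v X`, the tangential part of the
derivative in direction `v` of the tangent vector field `X` along the sphere. -/
def sphCovDeriv {n : ℕ} (X : Euc n → Euc n) (z : Euc n) : sphTangent z →ₗ[ℝ] sphTangent z :=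
  ((sphTangent z).orthogonalProjectionOnto.comp
    ((fderiv ℝ (radialExt X) z).comp (sphTangent z).subtypeL)).toLinearMap

/-- The covariant Hessian of `f` on the unit sphere, as an endomorphism `v ↦ ∇_v ∇ f` of the tangent
space (one index raised with the standard metric). -/
def sphHess {n : ℕ} (f : Euc n → ℝ) (z : Euc n) : sphTangent z →ₗ[ℝ] sphTangent z :=
  sphCovDeriv (sphGrad f) z

/-- The radii of curvature `r_ij = ∇_i ∇_j s + s g_ij` at the unit vector `z`, as an endomorphism of
the tangent space (one index raised with the standard metric), so that its eigenvalues and its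
determinant are the ones with respect to the standard metric. -/
def radii {n : ℕ} (s : Euc n → ℝ) (z : Euc n) : sphTangent z →ₗ[ℝ] sphTangent z :=
  sphHess s z + s z • LinearMap.id

/-- The inverse of the Gauss curvature, `S_{n-1} = det (∇_i ∇_j s + s g_ij)`. -/
def invGauss {n : ℕ} (s : Euc n → ℝ) (z : Euc n) : ℝ :=
  LinearMap.det (radii s z)

/-- The speed `F = S_{n-1} ^ (p / (n - 1))`. -/
def speed {n : ℕ} (p : ℝ) (s : Euc n → ℝ) (z : Euc n) : ℝ :=
  invGauss s z ^ (p / ((n : ℝ) - 1))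

/-- `κ` is a principal curvature at the boundary point with outer unit normal `z` of the body with
support function `s`: the reciprocal of an eigenvalue of the radii of curvature. -/
def IsPrincipalCurvature {n : ℕ} (s : Euc n → ℝ) (z : Euc n) (κ : ℝ) : Prop :=
  ∃ μ : ℝ, Module.End.HasEigenvalue (radii s z) μ ∧ κ = 1 / μ

/-- `{K_t}`, `t ∈ [0, t₀]`, is a smooth, strictly convex solution of the expanding Gauss curvature
flow `∂_t s = S_{n-1} ^ (p / (n - 1))` (with `Φ ≡ 1`). -/
structure IsSmoothStrictlyConvexSolution {n : ℕ} (p t₀ : ℝ) (K : ℝ → ConvexBody (Euc n)) :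
    Prop where
  /-- the bodies have non-empty interior -/
  interior_nonempty : ∀ t ∈ Set.Icc 0 t₀, (interior (K t : Set (Euc n))).Nonempty
  /-- the support function is smooth on the product of the unit sphere and `[0, t₀]` -/
  smooth : ContDiffOn ℝ ∞ (fun q : Euc n × ℝ => radialExt (supportFun (K q.2)) q.1)
    ({0}ᶜ ×ˢ Set.Icc 0 t₀)
  /-- the radii of curvature are positive definite -/
  strictly_convex : ∀ t ∈ Set.Icc 0 t₀, ∀ z : Euc n, ‖z‖ = 1 → ∀ v : sphTangent z, v ≠ 0 →
    0 < inner ℝ (radii (supportFun (K t)) z v) v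
  /-- the evolution equation of the support functions -/
  flow : ∀ t ∈ Set.Icc 0 t₀, ∀ z : Euc n, ‖z‖ = 1 →
    HasDerivWithinAt (fun τ => supportFun (K τ) z) (speed p (supportFun (K t)) z)
      (Set.Icc 0 t₀) t

end

open scoped Topology ContDiff
open Filter

/-! Everything follows from the linear growth `λ_i ≥ C₁ t` of the radii of curvature. Taking
reciprocals gives `κ_i ≤ 1 / (C₁ t)`. The upper bound on `F` bounds `∏ λ_k`; dividing by the other
`n - 2` factors, each at least `C₁ t`, bounds every `λ_i` from above, and this is the lower bound on
`κ_i`.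

The linear growth is a maximum principle for `h(x, t) = ‖x‖ s(x / ‖x‖, t)`. The Hessian of this
degree-one extension restricts to `r_ij` on the tangent spaces of the sphere (`inner_radii`), so
covariant derivatives become flat ones that commute with each other and with `∂_t`. The flow reads
`∂_t h = G` with `G(x) = ‖x‖ F(x / ‖x‖)`, hence `∂_t h_uu = G_uu`.

Let `μ` be the least eigenvalue over the whole sphere at a fixed time, attained at `z` in the
direction `u`. The point is moved along `z + τ e_i` and the direction along `u + τ a`, with `a`
chosen optimally. The second variation then bounds `h_uuii` below by `2 ∑_k h_uik² / λ_k`, up to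
multiples of `μ` (`second_variation`). After weighting by `1 / λ_i` and summing, this absorbs the
negative quadratic term of `(log det)''`, leaving `(log det)'' ≥ -(m + 2)` with `m = n - 1`
(`trace_second_variation`). On the hyperplane `⟨z, x⟩ = 1`, `F` is a power `α` of `‖x‖ ^ (m + 2) det
D²h` (`det_hessForm`). The powers of `‖x‖` contribute `1 + α (m + 2)` to `(log G)''`, so `(log G)''
≥ 1` and `G_uu ≥ G = F ≥ C₁` at `z` (`hessForm_time_deriv_ge`). Comparison with `c t` for `c < C₁`
concludes (`mul_le_hessForm`). -/

/-! ### One-variable second-derivative inequalities -/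

/-- Necessary second-order condition at a minimum. -/
theorem second_deriv_nonneg_of_min {f f' : ℝ → ℝ} {f'' : ℝ}
    (hf : ∀ τ, HasDerivAt f (f' τ) τ) (hf' : HasDerivAt f' f'' 0)
    (h0 : f 0 = 0) (hmin : ∀ τ, 0 ≤ f τ) : 0 ≤ f'' := by
  by_contra! hneg
  -- If `f'' < 0`, then `-f + (f'' / 4) τ²` still has positive second derivative `-f'' / 2` at `0`.
  -- It therefore has a local minimum there, which forces `f ≤ (f'' / 4) τ² < 0` at nearby `τ ≠ 0`.
  have hd : ∀ τ, HasDerivAt (fun τ => -f τ + f'' / 4 * τ ^ 2) (-f' τ + f'' / 2 * τ) τ := by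
    intro τ
    have := (hf τ).neg.add (((hasDerivAt_id τ).pow 2).const_mul (f'' / 4))
    refine this.congr_deriv ?_
    simp; ring
  have hd' : deriv (fun τ => -f τ + f'' / 4 * τ ^ 2) = fun τ => -f' τ + f'' / 2 * τ :=
    funext fun τ => (hd τ).deriv
  have hf0 : f' 0 = 0 := by
    have : IsLocalMin f 0 := Eventually.of_forall fun τ => by rw [h0]; exact hmin τ
    exact this.hasDerivAt_eq_zero (hf 0)
  have hdd : deriv (deriv (fun τ => -f τ + f'' / 4 * τ ^ 2)) 0 = -f'' / 2 := by
    rw [hd']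
    have := hf'.neg.add ((hasDerivAt_id (0 : ℝ)).const_mul (f'' / 2))
    refine (this.congr_deriv ?_).deriv
    ring
  have hloc : IsLocalMin (fun τ => -f τ + f'' / 4 * τ ^ 2) 0 := by
    apply isLocalMin_of_deriv_deriv_pos
    · rw [hdd]; linarith
    · rw [(hd 0).deriv, hf0]; simp
    · exact (hd 0).continuousAt
  have h1 : ∀ᶠ τ in 𝓝[≠] (0 : ℝ), 0 ≤ f'' / 4 * τ ^ 2 := by
    filter_upwards [hloc.filter_mono nhdsWithin_le_nhds] with τ hτ
    have := hmin τ
    simp only [h0] at hτ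
    nlinarith
  obtain ⟨τ, hτ, hne⟩ := (h1.and self_mem_nhdsWithin).exists
  have : 0 < τ ^ 2 := by have : τ ≠ 0 := hne; positivity
  nlinarith

/-- Lower bound for the second derivative of `exp L`. -/
theorem exp_second_deriv_ge {L L' : ℝ → ℝ} {L'' : ℝ}
    (hL : ∀ᶠ τ in 𝓝 0, HasDerivAt L (L' τ) τ) (hL' : HasDerivAt L' L'' 0)
    {g g' : ℝ → ℝ} {g'' : ℝ} (hg : ∀ τ, HasDerivAt g (g' τ) τ) (hg' : HasDerivAt g' g'' 0)
    (hgL : ∀ᶠ τ in 𝓝 0, g τ = Real.exp (L τ)) : g 0 * L'' ≤ g'' := by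
  have h1 : ∀ᶠ τ in 𝓝 0, g' τ = Real.exp (L τ) * L' τ := by
    filter_upwards [hgL.eventually_nhds, hL] with τ h1 h2
    exact (hg τ).unique (h2.exp.congr_of_eventuallyEq h1)
  have h2 := (hL.self_of_nhds.exp.mul hL').congr_of_eventuallyEq h1
  rw [hg'.unique h2, hgL.self_of_nhds]
  nlinarith [Real.exp_pos (L 0), mul_nonneg (Real.exp_pos (L 0)).le (sq_nonneg (L' 0))]

/-! ### Derivatives of determinants and inverse matrices -/

section Det

variable {ι : Type*} [Fintype ι] [DecidableEq ι]

/-- Jacobi's formula: in the Leibniz expansion, the terms that differentiate column `i` add up to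
the determinant with that column replaced, which Cramer's rule identifies with a diagonal entry of
`adjugate * M'`. -/
theorem hasDerivAt_det {M : ℝ → Matrix ι ι ℝ} {M' : Matrix ι ι ℝ} {τ : ℝ}
    (hM : ∀ i j, HasDerivAt (fun τ => M τ i j) (M' i j) τ) :
    HasDerivAt (fun τ => (M τ).det) (((M τ).adjugate * M').trace) τ := by
  have h1 : HasDerivAt (fun τ => (M τ).det)
      (∑ σ : Equiv.Perm ι, ((Equiv.Perm.sign σ : ℤ) : ℝ) *
        ∑ i, (∏ j ∈ Finset.univ.erase i, M τ (σ j) j) • M' (σ i) i) τ := by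
    simp only [Matrix.det_apply']
    refine HasDerivAt.fun_sum fun σ _ => HasDerivAt.const_mul _ ?_
    exact HasDerivAt.fun_finsetProd fun i _ => hM (σ i) i
  refine h1.congr_deriv ?_
  have h2 : ((M τ).adjugate * M').trace = ∑ i, ((M τ).updateCol i (fun k => M' k i)).det := by
    rw [Matrix.trace]
    refine Finset.sum_congr rfl fun i _ => ?_
    rw [← Matrix.cramer_apply, Matrix.cramer_eq_adjugate_mulVec]
    rfl
  rw [h2]
  simp only [Matrix.det_apply', Finset.mul_sum]
  rw [Finset.sum_comm]
  refine Finset.sum_congr rfl fun i _ => Finset.sum_congr rfl fun σ _ => ?_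
  congr 1
  rw [← Finset.mul_prod_erase _ _ (Finset.mem_univ i), smul_eq_mul, mul_comm]
  congr 1
  · simp
  · refine Finset.prod_congr rfl fun j hj => ?_
    rw [Matrix.updateCol_ne (Finset.ne_of_mem_erase hj)]

/-- Differentiability comes from the adjugate formula, whose entries are determinants; the value of
the derivative then follows by differentiating `M⁻¹ M = 1`. -/
theorem hasDerivAt_inv_entry {M : ℝ → Matrix ι ι ℝ} {M' : Matrix ι ι ℝ} {τ : ℝ}
    (hM : ∀ i j, HasDerivAt (fun τ => M τ i j) (M' i j) τ) (hdet : (M τ).det ≠ 0) (i j : ι) :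
    HasDerivAt (fun τ => (M τ)⁻¹ i j) ((-((M τ)⁻¹ * M' * (M τ)⁻¹)) i j) τ := by
  have hdiff : ∀ i j, DifferentiableAt ℝ (fun τ => (M τ)⁻¹ i j) τ := by
    intro i j
    simp only [Matrix.inv_def, Ring.inverse_eq_inv', Matrix.smul_apply, smul_eq_mul,
      Matrix.adjugate_apply]
    refine ((hasDerivAt_det hM).differentiableAt.inv hdet).mul ?_
    refine (hasDerivAt_det (M' := M'.updateRow j 0) fun k l => ?_).differentiableAt
    by_cases hk : k = j
    · subst hk; simpa using hasDerivAt_const τ _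
    · simpa [Matrix.updateRow_ne hk] using hM k l
  set N' : Matrix ι ι ℝ := fun i j => deriv (fun τ => (M τ)⁻¹ i j) τ
  have hN : ∀ i j, HasDerivAt (fun τ => (M τ)⁻¹ i j) (N' i j) τ := fun i j =>
    (hdiff i j).hasDerivAt
  have hprod : N' * M τ + (M τ)⁻¹ * M' = 0 := by
    ext k l
    have h1 : HasDerivAt (fun τ => ((M τ)⁻¹ * M τ) k l) ((N' * M τ + (M τ)⁻¹ * M') k l) τ := by
      simp only [Matrix.mul_apply, Matrix.add_apply, ← Finset.sum_add_distrib]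
      exact HasDerivAt.fun_sum fun m _ => (hN k m).mul (hM m l)
    have hev : ∀ᶠ s in 𝓝 τ, (M s).det ≠ 0 :=
      (hasDerivAt_det hM).continuousAt.eventually_ne hdet
    have h2 : HasDerivAt (fun τ => ((M τ)⁻¹ * M τ) k l) 0 τ := by
      refine (hasDerivAt_const τ ((1 : Matrix ι ι ℝ) k l)).congr_of_eventuallyEq ?_
      filter_upwards [hev] with s hs
      rw [Matrix.nonsing_inv_mul _ (isUnit_iff_ne_zero.2 hs)]
    exact h1.unique h2
  have hN' : N' = -((M τ)⁻¹ * M' * (M τ)⁻¹) := by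
    have h3 : N' * M τ = -((M τ)⁻¹ * M') := eq_neg_of_add_eq_zero_left hprod
    calc N' = N' * M τ * (M τ)⁻¹ := by
          rw [Matrix.mul_assoc, Matrix.mul_nonsing_inv _ (isUnit_iff_ne_zero.2 hdet), mul_one]
      _ = _ := by rw [h3, Matrix.neg_mul]
  rw [← hN']
  exact hN i j

/-- First and second logarithmic derivative of the determinant at a positive diagonal matrix. -/
theorem log_det_second_deriv {M M' : ℝ → Matrix ι ι ℝ} {M'' : Matrix ι ι ℝ} {lam : ι → ℝ}
    (hM : ∀ τ i j, HasDerivAt (fun τ => M τ i j) (M' τ i j) τ)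
    (hM' : ∀ i j, HasDerivAt (fun τ => M' τ i j) (M'' i j) 0)
    (h0 : M 0 = Matrix.diagonal lam) (hlam : ∀ i, 0 < lam i) :
    ∃ L' : ℝ → ℝ, (∀ᶠ τ in 𝓝 0, HasDerivAt (fun τ => Real.log (M τ).det) (L' τ) τ) ∧
      HasDerivAt L' (∑ i, (lam i)⁻¹ * M'' i i
        - ∑ i, ∑ k, (lam i)⁻¹ * (lam k)⁻¹ * (M' 0 i k * M' 0 k i)) 0 := by
  have hdet0 : (M 0).det ≠ 0 := by
    rw [h0, Matrix.det_diagonal]; exact Finset.prod_ne_zero_iff.2 fun i _ => (hlam i).ne'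
  have hev : ∀ᶠ s in 𝓝 (0 : ℝ), (M s).det ≠ 0 :=
    (hasDerivAt_det (hM 0)).continuousAt.eventually_ne hdet0
  refine ⟨fun τ => ((M τ)⁻¹ * M' τ).trace, ?_, ?_⟩
  · filter_upwards [hev] with τ hτ
    refine ((hasDerivAt_det (hM τ)).log hτ).congr_deriv ?_
    rw [Matrix.inv_def, Ring.inverse_eq_inv', Matrix.smul_mul, Matrix.trace_smul, smul_eq_mul,
      div_eq_inv_mul]
  · have hinv : (M 0)⁻¹ = Matrix.diagonal fun i => (lam i)⁻¹ := by
      refine Matrix.inv_eq_left_inv ?_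
      rw [h0, Matrix.diagonal_mul_diagonal]
      simp [(hlam _).ne']
    have h1 : HasDerivAt (fun τ => ((M τ)⁻¹ * M' τ).trace)
        (∑ i, ∑ k, ((-((M 0)⁻¹ * M' 0 * (M 0)⁻¹)) i k * M' 0 k i + (M 0)⁻¹ i k * M'' k i)) 0 := by
      simp only [Matrix.trace, Matrix.diag, Matrix.mul_apply (M := (M _)⁻¹) (N := M' _)]
      exact HasDerivAt.fun_sum fun i _ => HasDerivAt.fun_sum fun k _ =>
        (hasDerivAt_inv_entry (hM 0) hdet0 i k).mul (hM' k i)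
    refine h1.congr_deriv ?_
    rw [hinv]
    simp only [Finset.sum_add_distrib]
    rw [add_comm, sub_eq_add_neg, ← Finset.sum_neg_distrib]
    congr 1
    · refine Finset.sum_congr rfl fun i _ => ?_
      simp [Matrix.diagonal_apply]
    · refine Finset.sum_congr rfl fun i _ => ?_
      rw [← Finset.sum_neg_distrib]
      refine Finset.sum_congr rfl fun k _ => ?_
      rw [Matrix.neg_apply, Matrix.mul_diagonal, Matrix.diagonal_mul]
      ring

end Det

/-! ### Directional derivatives within a set -/

section DirDeriv

variable {W : Type*} [NormedAddCommGroup W] [NormedSpace ℝ W]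

/-- The derivative within `S` in direction `ξ`. -/
noncomputable def dirD (S : Set W) (ξ : W) (f : W → ℝ) (q : W) : ℝ := fderivWithin ℝ f S q ξ

variable {S : Set W}

theorem dirD_contDiffOn (hS : UniqueDiffOn ℝ S) {f : W → ℝ} (hf : ContDiffOn ℝ ∞ f S) (ξ : W) :
    ContDiffOn ℝ ∞ (dirD S ξ f) S :=
  (hf.fderivWithin hS (m := ∞) le_rfl).clm_apply contDiffOn_const

theorem dirD_congr {f g : W → ℝ} (h : Set.EqOn f g S) (ξ : W) :
    Set.EqOn (dirD S ξ f) (dirD S ξ g) S := fun q hq => by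
  unfold dirD; rw [fderivWithin_congr h (h hq)]

theorem dirD_dirD (hS : UniqueDiffOn ℝ S) {f : W → ℝ} (hf : ContDiffOn ℝ ∞ f S) (ξ η : W)
    {q : W} (hq : q ∈ S) :
    dirD S ξ (dirD S η f) q = fderivWithin ℝ (fderivWithin ℝ f S) S q ξ η := by
  have h1 : DifferentiableWithinAt ℝ (fderivWithin ℝ f S) S q :=
    ((hf.fderivWithin hS (m := ∞) le_rfl).differentiableOn (by simp)) q hq
  have h2 := h1.hasFDerivWithinAt.clm_apply (hasFDerivWithinAt_const η q S)
  unfold dirD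
  rw [h2.fderivWithin (hS q hq)]
  simp

/-- Derivatives within the set allow the end times of the closed interval. Their symmetry holds
there because every point is a limit of interior points. -/
theorem dirD_comm (hS : UniqueDiffOn ℝ S) (hcl : S ⊆ closure (interior S)) {f : W → ℝ}
    (hf : ContDiffOn ℝ ∞ f S) (ξ η : W) :
    Set.EqOn (dirD S ξ (dirD S η f)) (dirD S η (dirD S ξ f)) S := fun q hq => by
  rw [dirD_dirD hS hf _ _ hq, dirD_dirD hS hf _ _ hq]
  exact (hf q hq).isSymmSndFDerivWithinAt
    (by rw [minSmoothness_of_isRCLikeNormedField]; exact WithTop.coe_le_coe.2 (le_top (a := (2 : ℕ∞)))) hS (hcl hq) hq ξ η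

theorem hasDerivAt_line {f : W → ℝ} (hf : ContDiffOn ℝ ∞ f S) {q ξ : W} {τ₀ : ℝ}
    (h : ∀ᶠ τ in 𝓝 τ₀, q + τ • ξ ∈ S) :
    HasDerivAt (fun τ : ℝ => f (q + τ • ξ)) (dirD S ξ f (q + τ₀ • ξ)) τ₀ := by
  have hd : HasFDerivWithinAt f (fderivWithin ℝ f S (q + τ₀ • ξ)) S (q + τ₀ • ξ) :=
    ((hf.differentiableOn (by simp)) _ h.self_of_nhds).hasFDerivWithinAt
  have hl : HasDerivAt (fun τ : ℝ => q + τ • ξ) ξ τ₀ := by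
    simpa using ((hasDerivAt_id τ₀).smul_const ξ).const_add q
  exact HasFDerivWithinAt.comp_hasDerivAt τ₀ hd hl h

end DirDeriv

/-! ### Space-time domain and homogeneous extension -/

section Slab

variable {n : ℕ}

/-- The punctured space times the time interval `[0, t₀]`. -/
def slab (n : ℕ) (t₀ : ℝ) : Set (Euc n × ℝ) := {0}ᶜ ×ˢ Set.Icc 0 t₀

theorem mem_slab {t₀ : ℝ} {x : Euc n} {t : ℝ} :
    ((x, t) : Euc n × ℝ) ∈ slab n t₀ ↔ x ≠ 0 ∧ t ∈ Set.Icc 0 t₀ := Iff.rfl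

theorem slab_uniqueDiffOn {t₀ : ℝ} (ht : 0 < t₀) : UniqueDiffOn ℝ (slab n t₀) :=
  (isOpen_compl_singleton.uniqueDiffOn).prod (uniqueDiffOn_Icc ht)

theorem slab_subset_closure {t₀ : ℝ} (ht : 0 < t₀) :
    slab n t₀ ⊆ closure (interior (slab n t₀)) := by
  unfold slab
  rw [interior_prod_eq, interior_Icc, isOpen_compl_singleton.interior_eq, closure_prod_eq,
    closure_Ioo ht.ne]
  exact Set.prod_mono subset_closure subset_rfl

theorem hasDerivWithinAt_time {t₀ : ℝ} {f : Euc n × ℝ → ℝ} (hf : ContDiffOn ℝ ∞ f (slab n t₀))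
    {x : Euc n} (hx : x ≠ 0) {t : ℝ} (ht : t ∈ Set.Icc 0 t₀) :
    HasDerivWithinAt (fun τ => f (x, τ)) (dirD (slab n t₀) (0, 1) f (x, t)) (Set.Icc 0 t₀) t := by
  have hd := ((hf.differentiableOn (by simp)) _ (mem_slab.2 ⟨hx, ht⟩)).hasFDerivWithinAt
  have hl : HasDerivWithinAt (fun τ : ℝ => (x, τ)) ((0, 1) : Euc n × ℝ) (Set.Icc 0 t₀) t :=
    (hasDerivWithinAt_const t _ x).prodMk (hasDerivWithinAt_id t _)
  exact HasFDerivWithinAt.comp_hasDerivWithinAt t hd hl fun τ hτ => mem_slab.2 ⟨hx, hτ⟩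

theorem hasDerivAt_space {t₀ : ℝ} {f : Euc n × ℝ → ℝ} (hf : ContDiffOn ℝ ∞ f (slab n t₀))
    {x v : Euc n} {t τ₀ : ℝ} (hx : x + τ₀ • v ≠ 0) (ht : t ∈ Set.Icc 0 t₀) :
    HasDerivAt (fun τ : ℝ => f (x + τ • v, t))
      (dirD (slab n t₀) (v, 0) f (x + τ₀ • v, t)) τ₀ := by
  have hc : Continuous fun τ : ℝ => x + τ • v := by fun_prop
  have := hasDerivAt_line (q := (x, t)) (ξ := ((v, 0) : Euc n × ℝ)) (τ₀ := τ₀) hf (by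
    filter_upwards [hc.continuousAt.eventually_ne hx] with τ hτ
    simpa [mem_slab] using ⟨hτ, ht⟩)
  simpa using this

theorem hasDerivAt_norm_line {x v : Euc n} (hx : x ≠ 0) :
    HasDerivAt (fun τ : ℝ => ‖x + τ • v‖) (inner ℝ x v / ‖x‖) 0 := by
  have hl : HasDerivAt (fun τ : ℝ => x + τ • v) v 0 := by
    simpa using ((hasDerivAt_id (0 : ℝ)).smul_const v).const_add x
  have h1 := hl.norm_sq.sqrt (by simpa using hx)
  simp only [Real.sqrt_sq (norm_nonneg _)] at h1
  refine h1.congr_deriv ?_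
  simp only [zero_smul, add_zero]
  rw [mul_div_mul_left _ _ two_ne_zero]

/-- The extension of a time-dependent function on the sphere, homogeneous of degree one. -/
noncomputable def homExt (s : ℝ → Euc n → ℝ) (q : Euc n × ℝ) : ℝ :=
  ‖q.1‖ * radialExt (s q.2) q.1

theorem homExt_contDiffOn {t₀ : ℝ} {s : ℝ → Euc n → ℝ}
    (hs : ContDiffOn ℝ ∞ (fun q : Euc n × ℝ => radialExt (s q.2) q.1) (slab n t₀)) :
    ContDiffOn ℝ ∞ (homExt s) (slab n t₀) := by
  refine ContDiffOn.mul ?_ hs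
  exact contDiff_fst.contDiffOn.norm ℝ fun q hq => hq.1

theorem radialExt_smul {F : Type*} (f : Euc n → F) (x : Euc n) {c : ℝ} (hc : 0 < c) :
    radialExt f (c • x) = radialExt f x := by
  unfold radialExt
  rw [norm_smul, smul_smul, Real.norm_of_nonneg hc.le, mul_inv, mul_right_comm,
    inv_mul_cancel₀ hc.ne', one_mul]

theorem homExt_smul (s : ℝ → Euc n → ℝ) (x : Euc n) (t : ℝ) {c : ℝ} (hc : 0 < c) :
    homExt s (c • x, t) = c * homExt s (x, t) := by
  simp only [homExt, radialExt_smul _ x hc, norm_smul, Real.norm_of_nonneg hc.le, mul_assoc]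

/-- Differentiating `f(c x) = a f(x)` in `x` gives `c Df(c x) = a Df(x)`: each spatial derivative
lowers the degree of homogeneity by one. -/
theorem dirD_smul_point {t₀ : ℝ} {f : Euc n × ℝ → ℝ} (hf : ContDiffOn ℝ ∞ f (slab n t₀))
    {a b : ℝ} {c : ℝ} (hc : 0 < c) (hab : a = c * b) {t : ℝ} (ht : t ∈ Set.Icc 0 t₀)
    (hom : ∀ x : Euc n, x ≠ 0 → f (c • x, t) = a * f (x, t)) (v : Euc n) {x : Euc n} (hx : x ≠ 0) :
    dirD (slab n t₀) (v, 0) f (c • x, t) = b * dirD (slab n t₀) (v, 0) f (x, t) := by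
  have hcx : c • x ≠ 0 := smul_ne_zero hc.ne' hx
  have h1 := hasDerivAt_space (τ₀ := 0) (x := c • x) (v := c • v) hf
    (by rwa [zero_smul, add_zero]) ht
  have h2 := (hasDerivAt_space (τ₀ := 0) (v := v) hf (by simpa using hx) ht).const_mul a
  have hev : ∀ᶠ τ in 𝓝 (0 : ℝ), x + τ • v ≠ 0 := by
    have hcont : Continuous fun τ : ℝ => x + τ • v := by fun_prop
    exact hcont.continuousAt.eventually_ne (by simpa using hx)
  have h3 := h1.congr_of_eventuallyEq (f₁ := fun τ => a * f (x + τ • v, t)) (by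
    filter_upwards [hev] with τ hτ
    rw [← hom _ hτ, smul_add, smul_comm])
  have h4 := h3.unique h2
  simp only [zero_smul, add_zero] at h4
  have h5 : dirD (slab n t₀) (c • v, 0) f (c • x, t)
      = c * dirD (slab n t₀) (v, 0) f (c • x, t) := by
    unfold dirD
    rw [← smul_eq_mul, ← map_smul]; simp
  rw [h5, hab, mul_assoc] at h4
  exact mul_left_cancel₀ hc.ne' h4

end Slab

/-! ### Euclidean Hessian of the extension and radii of curvature -/

section Hessian

variable {n : ℕ} {t₀ : ℝ} {s : ℝ → Euc n → ℝ}

/-- The spatial Hessian of the homogeneous extension. -/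
noncomputable def hessForm (t₀ : ℝ) (s : ℝ → Euc n → ℝ) (q : Euc n × ℝ) :
    Euc n →L[ℝ] Euc n →L[ℝ] ℝ :=
  (fderivWithin ℝ (fderivWithin ℝ (homExt s) (slab n t₀)) (slab n t₀) q).bilinearComp
    (ContinuousLinearMap.inl ℝ (Euc n) ℝ) (ContinuousLinearMap.inl ℝ (Euc n) ℝ)

theorem hessForm_apply (hpos : 0 < t₀) (hh : ContDiffOn ℝ ∞ (homExt s) (slab n t₀))
    {q : Euc n × ℝ} (hq : q ∈ slab n t₀) (a b : Euc n) :
    hessForm t₀ s q a b = dirD (slab n t₀) (a, 0) (dirD (slab n t₀) (b, 0) (homExt s)) q := by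
  rw [dirD_dirD (slab_uniqueDiffOn hpos) hh _ _ hq]
  rfl

theorem hessForm_comm (hpos : 0 < t₀) (hh : ContDiffOn ℝ ∞ (homExt s) (slab n t₀))
    {q : Euc n × ℝ} (hq : q ∈ slab n t₀) (a b : Euc n) :
    hessForm t₀ s q a b = hessForm t₀ s q b a := by
  rw [hessForm_apply hpos hh hq, hessForm_apply hpos hh hq]
  exact dirD_comm (slab_uniqueDiffOn hpos) (slab_subset_closure hpos) hh _ _ hq

theorem hessForm_contDiffOn (hpos : 0 < t₀) (hh : ContDiffOn ℝ ∞ (homExt s) (slab n t₀))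
    (a b : Euc n) : ContDiffOn ℝ ∞ (fun q => hessForm t₀ s q a b) (slab n t₀) :=
  (dirD_contDiffOn (slab_uniqueDiffOn hpos)
    (dirD_contDiffOn (slab_uniqueDiffOn hpos) hh (b, 0)) (a, 0)).congr
      fun _ hq => hessForm_apply hpos hh hq a b

theorem hessForm_continuousOn (hpos : 0 < t₀) (hh : ContDiffOn ℝ ∞ (homExt s) (slab n t₀)) :
    ContinuousOn (fun r : (Euc n × ℝ) × Euc n => hessForm t₀ s r.1 r.2 r.2)
      (slab n t₀ ×ˢ Set.univ) := by
  have h1 : ContinuousOn (fderivWithin ℝ (fderivWithin ℝ (homExt s) (slab n t₀)) (slab n t₀))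
      (slab n t₀) :=
    ((hh.fderivWithin (slab_uniqueDiffOn hpos) (m := ∞) le_rfl).fderivWithin
      (slab_uniqueDiffOn hpos) (m := ∞) le_rfl).continuousOn
  have h2 : ContinuousOn (fun r : (Euc n × ℝ) × Euc n => ((r.2, 0) : Euc n × ℝ))
      (slab n t₀ ×ˢ Set.univ) := by fun_prop
  exact ((h1.comp continuousOn_fst fun r hr => hr.1).clm_apply h2).clm_apply h2

theorem dirD_homExt_smul (hh : ContDiffOn ℝ ∞ (homExt s) (slab n t₀)) {t : ℝ}
    (ht : t ∈ Set.Icc 0 t₀) {c : ℝ} (hc : 0 < c) (v : Euc n) {x : Euc n} (hx : x ≠ 0) :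
    dirD (slab n t₀) (v, 0) (homExt s) (c • x, t) = dirD (slab n t₀) (v, 0) (homExt s) (x, t) := by
  rw [dirD_smul_point (a := c) (b := 1) hh hc (by ring) ht (fun y _ => homExt_smul s y t hc) v hx,
    one_mul]

theorem hessForm_smul (hpos : 0 < t₀) (hh : ContDiffOn ℝ ∞ (homExt s) (slab n t₀)) {t : ℝ}
    (ht : t ∈ Set.Icc 0 t₀) {c : ℝ} (hc : 0 < c) (a b : Euc n) {x : Euc n} (hx : x ≠ 0) :
    hessForm t₀ s (c • x, t) a b = c⁻¹ * hessForm t₀ s (x, t) a b := by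
  rw [hessForm_apply hpos hh (mem_slab.2 ⟨smul_ne_zero hc.ne' hx, ht⟩),
    hessForm_apply hpos hh (mem_slab.2 ⟨hx, ht⟩)]
  refine dirD_smul_point (a := 1) (dirD_contDiffOn (slab_uniqueDiffOn hpos) hh _) hc ?_ ht ?_ a hx
  · rw [mul_inv_cancel₀ hc.ne']
  · intro y hy
    rw [one_mul, dirD_homExt_smul hh ht hc b hy]

/-- Euler's relation: first derivatives of a degree-one function are constant along rays, so their
radial derivative vanishes. -/
theorem hessForm_self_left (hpos : 0 < t₀) (hh : ContDiffOn ℝ ∞ (homExt s) (slab n t₀)) {t : ℝ}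
    (ht : t ∈ Set.Icc 0 t₀) (b : Euc n) {x : Euc n} (hx : x ≠ 0) :
    hessForm t₀ s (x, t) x b = 0 := by
  rw [hessForm_apply hpos hh (mem_slab.2 ⟨hx, ht⟩)]
  have h1 := hasDerivAt_space (x := x) (v := x) (τ₀ := 0)
    (dirD_contDiffOn (slab_uniqueDiffOn hpos) hh (b, 0)) (by simpa using hx) ht
  simp only [zero_smul, add_zero] at h1
  refine h1.unique ((hasDerivAt_const (0 : ℝ)
    (dirD (slab n t₀) (b, 0) (homExt s) (x, t))).congr_of_eventuallyEq ?_)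
  filter_upwards [lt_mem_nhds (show (-1 : ℝ) < 0 by norm_num)] with τ hτ
  rw [show x + τ • x = (1 + τ) • x by rw [add_smul, one_smul],
    dirD_homExt_smul hh ht (by linarith) b hx]

theorem hessForm_self_right (hpos : 0 < t₀) (hh : ContDiffOn ℝ ∞ (homExt s) (slab n t₀)) {t : ℝ}
    (ht : t ∈ Set.Icc 0 t₀) (b : Euc n) {x : Euc n} (hx : x ≠ 0) :
    hessForm t₀ s (x, t) b x = 0 := by
  rw [hessForm_comm hpos hh (mem_slab.2 ⟨hx, ht⟩), hessForm_self_left hpos hh ht b hx]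

/-- At a unit vector the derivative of `x / ‖x‖` fixes tangent vectors, so extending the gradient
radially does not change its tangential derivative. The orthogonal projection is invisible when
paired with a tangent vector. -/
theorem inner_sphHess {f : Euc n → ℝ} {z : Euc n} (hz : ‖z‖ = 1)
    (hf : ContDiffOn ℝ ∞ (radialExt f) {0}ᶜ) (v w : sphTangent z) :
    HasDerivAt (fun τ : ℝ => fderiv ℝ (radialExt f) (z + τ • (v : Euc n)) (w : Euc n))
      (inner ℝ (sphHess f z v) w) 0 := by
  have hz0 : z ≠ 0 := by rintro rfl; simp at hz
  have hfz : ContDiffAt ℝ ∞ (radialExt f) z := hf.contDiffAt (isOpen_compl_singleton.mem_nhds hz0)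
  have hX : DifferentiableAt ℝ (sphGrad f) z := by
    unfold sphGrad gradient
    exact (InnerProductSpace.toDual ℝ (Euc n)).symm.toContinuousLinearEquiv.differentiableAt.comp z
      ((hfz.fderiv_right (m := ∞) le_rfl).differentiableAt (by simp))
  have hN : ContDiffAt ℝ ∞ (fun x : Euc n => ‖x‖⁻¹ • x) z :=
    ((contDiffAt_id.norm ℝ hz0).inv (by simpa using hz0)).smul contDiffAt_id
  have hNz : (fun x : Euc n => ‖x‖⁻¹ • x) z = z := by simp [hz]
  have hvz : inner ℝ z (v : Euc n) = 0 :=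
    Submodule.mem_orthogonal_singleton_iff_inner_right.1 v.2
  have hl : HasDerivAt (fun τ : ℝ => z + τ • (v : Euc n)) (v : Euc n) 0 := by
    simpa using ((hasDerivAt_id (0 : ℝ)).smul_const (v : Euc n)).const_add z
  have hNv : HasDerivAt (fun τ : ℝ => ‖z + τ • (v : Euc n)‖⁻¹ • (z + τ • (v : Euc n)))
      (v : Euc n) 0 := by
    have h1 := ((hasDerivAt_norm_line (v := (v : Euc n)) hz0).inv (by simpa using hz0)).smul hl
    refine h1.congr_deriv ?_
    simp [hz, hvz]
  have hXN : DifferentiableAt ℝ (radialExt (sphGrad f)) z := by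
    have hX' : DifferentiableAt ℝ (sphGrad f) ((fun x : Euc n => ‖x‖⁻¹ • x) z) := by rwa [hNz]
    exact DifferentiableAt.comp (g := sphGrad f) z hX' (hN.differentiableAt (by simp))
  have e1 : HasDerivAt (fun τ : ℝ => radialExt (sphGrad f) (z + τ • (v : Euc n)))
      (fderiv ℝ (radialExt (sphGrad f)) z (v : Euc n)) 0 :=
    hXN.hasFDerivAt.comp_hasDerivAt_of_eq 0 hl (by simp)
  have e2 : HasDerivAt (fun τ : ℝ => radialExt (sphGrad f) (z + τ • (v : Euc n)))
      (fderiv ℝ (sphGrad f) z (v : Euc n)) 0 :=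
    hX.hasFDerivAt.comp_hasDerivAt_of_eq 0 hNv (by simp [hz])
  have e3 : HasDerivAt (fun τ : ℝ => sphGrad f (z + τ • (v : Euc n)))
      (fderiv ℝ (sphGrad f) z (v : Euc n)) 0 :=
    hX.hasFDerivAt.comp_hasDerivAt_of_eq 0 hl (by simp)
  have e4 := e3.inner ℝ (hasDerivAt_const (0 : ℝ) (w : Euc n))
  have e5 : inner ℝ (sphHess f z v) w = inner ℝ (fderiv ℝ (sphGrad f) z (v : Euc n)) (w : Euc n) := by
    rw [← e1.unique e2]
    exact Submodule.inner_orthogonalProjectionOnto_eq_of_mem_right w _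
  rw [e5]
  simpa [sphGrad, inner_gradient_left] using e4

/-- Differentiating the product `‖x‖ * radialExt s` twice in tangent directions, the second
derivative of the norm yields the term `s g_ij` and that of `radialExt s` the covariant Hessian; the
mixed terms vanish by orthogonality to `z`. -/
theorem inner_radii (hpos : 0 < t₀)
    (hs : ContDiffOn ℝ ∞ (fun q : Euc n × ℝ => radialExt (s q.2) q.1) (slab n t₀))
    {t : ℝ} (ht : t ∈ Set.Icc 0 t₀) {z : Euc n} (hz : ‖z‖ = 1) (v w : sphTangent z) :
    inner ℝ (radii (s t) z v) w = hessForm t₀ s (z, t) v w := by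
  have hz0 : z ≠ 0 := by rintro rfl; simp at hz
  have hh := homExt_contDiffOn hs
  have hf : ContDiffOn ℝ ∞ (radialExt (s t)) {0}ᶜ :=
    hs.comp (f := fun x : Euc n => (x, t)) (contDiff_prodMk_left t).contDiffOn
      fun x hx => mem_slab.2 ⟨hx, ht⟩
  have hdw : ∀ x : Euc n, x ≠ 0 → dirD (slab n t₀) (w, 0) (homExt s) (x, t) =
      inner ℝ x (w : Euc n) / ‖x‖ * radialExt (s t) x +
        ‖x‖ * fderiv ℝ (radialExt (s t)) x (w : Euc n) := by
    intro x hx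
    have h1 := hasDerivAt_space (x := x) (v := (w : Euc n)) (τ₀ := 0) hh (by simpa using hx) ht
    have hl : HasDerivAt (fun τ : ℝ => x + τ • (w : Euc n)) (w : Euc n) 0 := by
      simpa using ((hasDerivAt_id (0 : ℝ)).smul_const (w : Euc n)).const_add x
    have hfx : DifferentiableAt ℝ (radialExt (s t)) x :=
      (hf.contDiffAt (isOpen_compl_singleton.mem_nhds hx)).differentiableAt (by simp)
    have h2 : HasDerivAt (fun τ : ℝ => radialExt (s t) (x + τ • (w : Euc n)))
        (fderiv ℝ (radialExt (s t)) x (w : Euc n)) 0 :=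
      hfx.hasFDerivAt.comp_hasDerivAt_of_eq 0 hl (by simp)
    have h3 := (hasDerivAt_norm_line (v := (w : Euc n)) hx).mul h2
    have := h1.unique h3
    simpa using this
  have hvz : inner ℝ z (v : Euc n) = 0 :=
    Submodule.mem_orthogonal_singleton_iff_inner_right.1 v.2
  have hwz : inner ℝ z (w : Euc n) = 0 :=
    Submodule.mem_orthogonal_singleton_iff_inner_right.1 w.2
  have hl : HasDerivAt (fun τ : ℝ => z + τ • (v : Euc n)) (v : Euc n) 0 := by
    simpa using ((hasDerivAt_id (0 : ℝ)).smul_const (v : Euc n)).const_add z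
  have hnl := hasDerivAt_norm_line (v := (v : Euc n)) hz0
  have hev : ∀ᶠ τ in 𝓝 (0 : ℝ), z + τ • (v : Euc n) ≠ 0 :=
    hl.continuousAt.eventually_ne (by simpa using hz0)
  rw [hessForm_apply hpos hh (mem_slab.2 ⟨hz0, ht⟩)]
  have k1 := hasDerivAt_space (x := z) (v := (v : Euc n)) (τ₀ := 0)
    (dirD_contDiffOn (slab_uniqueDiffOn hpos) hh ((w : Euc n), 0)) (by simpa using hz0) ht
  have hfz : DifferentiableAt ℝ (radialExt (s t)) z :=
    (hf.contDiffAt (isOpen_compl_singleton.mem_nhds hz0)).differentiableAt (by simp)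
  have k2 : HasDerivAt (fun τ : ℝ => radialExt (s t) (z + τ • (v : Euc n)))
      (fderiv ℝ (radialExt (s t)) z (v : Euc n)) 0 :=
    hfz.hasFDerivAt.comp_hasDerivAt_of_eq 0 hl (by simp)
  have k3 := (((hl.inner ℝ (hasDerivAt_const (0 : ℝ) (w : Euc n))).div hnl
    (by simpa using hz0)).mul k2).add (hnl.mul (inner_sphHess hz hf v w))
  have k4 := k1.unique (k3.congr_of_eventuallyEq (by
    filter_upwards [hev] with τ hτ using hdw _ hτ))
  have hrad : radialExt (s t) z = s t z := by simp [radialExt, hz]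
  simp only [zero_smul, add_zero] at k4
  rw [k4]
  simp [radii, inner_add_left, hz, hvz, hwz, hrad, real_inner_smul_left]
  ring

end Hessian

/-! ### Orthonormal frames and the determinant on a tangent hyperplane -/

section Frames

variable {n : ℕ} {ι : Type*} [Fintype ι]

theorem frame_decomp {z : Euc n} (hz : ‖z‖ = 1) (e : OrthonormalBasis ι ℝ (sphTangent z))
    (y : Euc n) : y = ∑ i, inner ℝ (e i : Euc n) y • (e i : Euc n) + inner ℝ z y • z := by
  have hmem : y - inner ℝ z y • z ∈ sphTangent z := by
    rw [Submodule.mem_orthogonal_singleton_iff_inner_right, inner_sub_right, inner_smul_right,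
      real_inner_self_eq_norm_sq, hz]
    ring
  have h1 := congrArg (Subtype.val) (e.sum_repr ⟨_, hmem⟩)
  rw [Submodule.coe_sum] at h1
  have h2 : ∀ i, e.repr ⟨_, hmem⟩ i = inner ℝ (e i : Euc n) y := by
    intro i
    have : inner ℝ (e i : Euc n) z = 0 :=
      Submodule.mem_orthogonal_singleton_iff_inner_left.1 (e i).2
    rw [e.repr_apply_apply, Submodule.coe_inner, inner_sub_right, inner_smul_right, this]
    ring
  simp only [Submodule.coe_smul, h2] at h1
  rw [h1]; abel

theorem inner_frame_decomp {z : Euc n} (hz : ‖z‖ = 1) (e : OrthonormalBasis ι ℝ (sphTangent z))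
    (x y : Euc n) : inner ℝ x y =
      ∑ i, inner ℝ (e i : Euc n) x * inner ℝ (e i : Euc n) y + inner ℝ z x * inner ℝ z y := by
  conv_lhs => rw [frame_decomp hz e y]
  rw [inner_add_right, inner_sum]
  simp only [inner_smul_right, real_inner_comm x, mul_comm]

theorem finrank_sphTangent {m : ℕ} {z : Euc (m + 1)} (hz : ‖z‖ = 1) :
    Module.finrank ℝ (sphTangent z) = m := by
  have hz0 : z ≠ 0 := by rintro rfl; simp at hz
  have : Fact (Module.finrank ℝ (Euc (m + 1)) = m + 1) := ⟨by simp⟩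
  exact Submodule.finrank_orthogonal_span_singleton hz0

/-- The determinant of the Hessian of the homogeneous extension on an affine hyperplane. -/
theorem det_hessForm {m : ℕ} {t₀ : ℝ} {s : ℝ → Euc (m + 1) → ℝ} (hpos : 0 < t₀)
    (hs : ContDiffOn ℝ ∞ (fun q : Euc (m + 1) × ℝ => radialExt (s q.2) q.1) (slab (m + 1) t₀))
    {t : ℝ} (ht : t ∈ Set.Icc 0 t₀) {z : Euc (m + 1)} (hz : ‖z‖ = 1)
    (e : OrthonormalBasis (Fin m) ℝ (sphTangent z)) {x : Euc (m + 1)} (hx : inner ℝ z x = 1) :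
    invGauss (s t) (‖x‖⁻¹ • x) = ‖x‖ ^ (m + 2) *
      (Matrix.of fun k l => hessForm t₀ s (x, t) (e k) (e l)).det := by
  have hh := homExt_contDiffOn hs
  have hx0 : x ≠ 0 := by rintro rfl; simp at hx
  have hxn : 0 < ‖x‖ := norm_pos_iff.2 hx0
  set ν := ‖x‖⁻¹ • x with hν
  have hν1 : ‖ν‖ = 1 := by
    rw [hν, norm_smul, norm_inv, norm_norm, inv_mul_cancel₀ hxn.ne']
  have hν0 : ν ≠ 0 := by rw [← norm_pos_iff, hν1]; norm_num
  have hxν : x = ‖x‖ • ν := by rw [hν, smul_smul, mul_inv_cancel₀ hxn.ne', one_smul]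
  have hzν : inner ℝ z ν = ‖x‖⁻¹ := by rw [hν, inner_smul_right, hx, mul_one]
  let f : OrthonormalBasis (Fin m) ℝ (sphTangent ν) :=
    (stdOrthonormalBasis ℝ (sphTangent ν)).reindex (finCongr (finrank_sphTangent hν1))
  let Q : Matrix (Fin m) (Fin m) ℝ := Matrix.of fun k i => inner ℝ (f i : Euc (m + 1)) (e k)
  let a : Fin m → ℝ := fun k => inner ℝ ν (e k : Euc (m + 1))
  let R : Matrix (Fin m) (Fin m) ℝ :=
    Matrix.of fun i j => hessForm t₀ s (ν, t) (f i) (f j)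
  have hR : R.det = invGauss (s t) ν := by
    unfold invGauss
    rw [← LinearMap.det_toMatrix f.toBasis, ← Matrix.det_transpose]
    congr 1
    ext i j
    rw [LinearMap.toMatrix_apply, Matrix.transpose_apply]
    simp only [OrthonormalBasis.coe_toBasis, OrthonormalBasis.coe_toBasis_repr_apply,
      OrthonormalBasis.repr_apply_apply]
    rw [real_inner_comm, inner_radii hpos hs ht hν1]
    rfl
  -- Homogeneity of degree `-1` moves the base point to `ν`. The components of `e k` along `ν` lie
  -- in the kernel of the Hessian, so only the projections to the tangent space at `ν`, recorded in
  -- `Q`, matter.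
  have hM : (Matrix.of fun k l => hessForm t₀ s (x, t) (e k) (e l)) =
      ‖x‖⁻¹ • (Q * R * Q.transpose) := by
    ext k l
    rw [Matrix.of_apply, hxν, hessForm_smul hpos hh ht hxn _ _ hν0, ← hxν, Matrix.smul_apply,
      smul_eq_mul]
    congr 1
    conv_lhs => rw [frame_decomp hν1 f (e k : Euc (m + 1)), frame_decomp hν1 f (e l : Euc (m + 1))]
    simp only [map_add, map_smul, map_sum, add_apply,
      smul_apply, sum_apply,
      hessForm_self_left hpos hh ht _ hν0, hessForm_self_right hpos hh ht _ hν0, smul_eq_mul,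
      mul_zero, add_zero, Finset.sum_const_zero]
    simp only [Matrix.mul_apply, Matrix.transpose_apply, Q, R, Matrix.of_apply, Finset.sum_mul,
      Finset.mul_sum]
    refine Finset.sum_congr rfl fun i _ => Finset.sum_congr rfl fun j _ => ?_
    ring
  -- `Q Qᵀ` is the identity minus the rank-one matrix `a aᵀ`, so its determinant is `1 - |a|² = ⟨z,
  -- ν⟩²`.
  have hQ : Q.det * Q.det = (‖x‖⁻¹) ^ 2 := by
    have h1 : Q * Q.transpose = 1 - Matrix.of (fun k (_ : Unit) => a k) *
        Matrix.of (fun (_ : Unit) k => a k) := by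
      ext k l
      have h2 := inner_frame_decomp hν1 f (e k : Euc (m + 1)) (e l : Euc (m + 1))
      have h3 : inner ℝ (e k : Euc (m + 1)) (e l : Euc (m + 1)) =
          (1 : Matrix (Fin m) (Fin m) ℝ) k l := by
        rw [← Submodule.coe_inner, orthonormal_iff_ite.1 e.orthonormal k l, Matrix.one_apply]
      rw [Matrix.sub_apply, ← h3, h2]
      simp [Matrix.mul_apply, Q, a]
    have h4 := inner_frame_decomp hz e ν ν
    rw [real_inner_self_eq_norm_sq, hν1, hzν] at h4
    calc Q.det * Q.det = (Q * Q.transpose).det := by rw [Matrix.det_mul, Matrix.det_transpose]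
      _ = 1 - ∑ k, a k * a k := by
        rw [h1, Matrix.det_one_sub_mul_comm, Matrix.det_unique]
        simp [Matrix.mul_apply]
      _ = _ := by
        have : ∑ k, a k * a k = ∑ i, inner ℝ (e i : Euc (m + 1)) ν * inner ℝ (e i : Euc (m + 1)) ν :=
          Finset.sum_congr rfl fun k _ => by simp only [a, real_inner_comm]
        rw [this]; linarith
  rw [hM, Matrix.det_smul, Matrix.det_mul, Matrix.det_mul, Matrix.det_transpose, hR,
    Fintype.card_fin]
  have : Q.det * invGauss (s t) ν * Q.det = (‖x‖⁻¹) ^ 2 * invGauss (s t) ν := by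
    rw [← hQ]; ring
  rw [this, pow_add, inv_pow, inv_pow]
  field_simp

end Frames

/-! ### Second variation at a minimal radius of curvature -/

section MaximumPrinciple

variable {n : ℕ} {t₀ : ℝ} {s : ℝ → Euc n → ℝ}

theorem norm_sq_add_smul {z e : Euc n} (hz : ‖z‖ = 1) (he : ‖e‖ = 1) (hze : inner ℝ z e = 0)
    (τ : ℝ) : ‖z + τ • e‖ ^ 2 = 1 + τ ^ 2 := by
  rw [norm_add_sq_real, inner_smul_right, hze, norm_smul, hz, he]
  simp

theorem inner_add_smul_self {z e : Euc n} (hz : ‖z‖ = 1) (hze : inner ℝ z e = 0) (τ : ℝ) :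
    inner ℝ z (z + τ • e) = 1 := by
  rw [inner_add_right, inner_smul_right, hze, real_inner_self_eq_norm_sq, hz]; simp

theorem add_smul_ne_zero {z e : Euc n} (hz : ‖z‖ = 1) (hze : inner ℝ z e = 0) (τ : ℝ) :
    z + τ • e ≠ 0 := by
  intro h
  have := inner_add_smul_self hz hze τ
  rw [h] at this; simp at this

/-- A lower bound for the Hessian on the unit sphere gives one at every point. -/
theorem hessForm_ge_of_sphere (hpos : 0 < t₀) (hh : ContDiffOn ℝ ∞ (homExt s) (slab n t₀)) {t : ℝ}
    (ht : t ∈ Set.Icc 0 t₀) {μ : ℝ}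
    (hmin : ∀ z v : Euc n, ‖z‖ = 1 → inner ℝ z v = 0 → μ * ‖v‖ ^ 2 ≤ hessForm t₀ s (z, t) v v)
    {x : Euc n} (hx : x ≠ 0) (w : Euc n) :
    μ * (‖x‖⁻¹ * (‖w‖ ^ 2 - (‖x‖⁻¹ * inner ℝ x w) ^ 2)) ≤ hessForm t₀ s (x, t) w w := by
  have hxn : 0 < ‖x‖ := norm_pos_iff.2 hx
  set ν := ‖x‖⁻¹ • x with hν
  have hν1 : ‖ν‖ = 1 := by
    rw [hν, norm_smul, norm_inv, norm_norm, inv_mul_cancel₀ hxn.ne']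
  have hν0 : ν ≠ 0 := by rw [← norm_pos_iff, hν1]; norm_num
  have hxν : x = ‖x‖ • ν := by rw [hν, smul_smul, mul_inv_cancel₀ hxn.ne', one_smul]
  have hνw : inner ℝ ν w = ‖x‖⁻¹ * inner ℝ x w := by rw [hν, real_inner_smul_left]
  rw [hxν, hessForm_smul hpos hh ht hxn _ _ hν0, ← hxν, ← hνw]
  have h1 := hmin ν (w - inner ℝ ν w • ν) hν1 (by
    rw [inner_sub_right, inner_smul_right, real_inner_self_eq_norm_sq, hν1]; ring)
  have h2 : hessForm t₀ s (ν, t) (w - inner ℝ ν w • ν) (w - inner ℝ ν w • ν) =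
      hessForm t₀ s (ν, t) w w := by
    simp only [map_sub, map_smul, sub_apply, smul_apply, hessForm_self_left hpos hh ht _ hν0,
      hessForm_self_right hpos hh ht _ hν0, smul_zero, sub_zero]
  have h3 : ‖w - inner ℝ ν w • ν‖ ^ 2 = ‖w‖ ^ 2 - (inner ℝ ν w) ^ 2 := by
    rw [norm_sub_sq_real, inner_smul_right, norm_smul, hν1, real_inner_comm, Real.norm_eq_abs,
      mul_one, sq_abs]
    ring
  rw [h2, h3] at h1
  calc μ * (‖x‖⁻¹ * (‖w‖ ^ 2 - (inner ℝ ν w) ^ 2))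
      = ‖x‖⁻¹ * (μ * (‖w‖ ^ 2 - (inner ℝ ν w) ^ 2)) := by ring
    _ ≤ _ := mul_le_mul_of_nonneg_left h1 (inv_nonneg.2 hxn.le)

theorem inv_bounds_of_sq_eq {r τ : ℝ} (hr : 0 < r) (h : r ^ 2 = 1 + τ ^ 2) :
    1 - τ ^ 2 / 2 ≤ r⁻¹ ∧ r⁻¹ * r⁻¹ ^ 2 ≤ 1 := by
  have hr1 : 1 ≤ r := by nlinarith [sq_nonneg τ]
  have hinv : r⁻¹ ≤ 1 := inv_le_one_of_one_le₀ hr1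
  have hinv0 : 0 < r⁻¹ := inv_pos.2 hr
  constructor
  · rw [← one_div, le_div_iff₀ hr]
    nlinarith [sq_nonneg (r - 1), mul_nonneg (sq_nonneg (r - 1)) hr.le]
  · rw [← pow_succ']
    exact pow_le_one₀ hinv0.le hinv

/-- The second variation inequality at a minimum `μ` of the Hessian over unit tangent vectors. -/
theorem second_variation (hpos : 0 < t₀) (hh : ContDiffOn ℝ ∞ (homExt s) (slab n t₀)) {t : ℝ}
    (ht : t ∈ Set.Icc 0 t₀) {μ : ℝ} (hμ : 0 ≤ μ)
    (hmin : ∀ z v : Euc n, ‖z‖ = 1 → inner ℝ z v = 0 → μ * ‖v‖ ^ 2 ≤ hessForm t₀ s (z, t) v v)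
    {z e u a : Euc n} (hz : ‖z‖ = 1) (he : ‖e‖ = 1) (hze : inner ℝ z e = 0)
    (hu : ‖u‖ = 1) (hzu : inner ℝ z u = 0) (hza : inner ℝ z a = 0)
    (hμu : hessForm t₀ s (z, t) u u = μ) :
    0 ≤ dirD (slab n t₀) (e, 0) (dirD (slab n t₀) (e, 0) fun q => hessForm t₀ s q u u) (z, t)
      + 4 * dirD (slab n t₀) (e, 0) (fun q => hessForm t₀ s q u a) (z, t)
      + 2 * hessForm t₀ s (z, t) a a - μ * (2 * ‖a‖ ^ 2 - 1 - 2 * (inner ℝ e u) ^ 2) := by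
  have hS := slab_uniqueDiffOn (n := n) hpos
  have hne := add_smul_ne_zero hz hze
  have hAs := hessForm_contDiffOn hpos hh u u
  have hBs := hessForm_contDiffOn hpos hh u a
  have hCs := hessForm_contDiffOn hpos hh a a
  have hD : ∀ {f : Euc n × ℝ → ℝ}, ContDiffOn ℝ ∞ f (slab n t₀) → ∀ τ : ℝ,
      HasDerivAt (fun τ : ℝ => f (z + τ • e, t)) (dirD (slab n t₀) (e, 0) f (z + τ • e, t)) τ :=
    fun hf τ => hasDerivAt_space hf (hne τ) ht
  have hA := hD hAs
  have hB := hD hBs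
  have hC := hD hCs
  have hA' := hD (dirD_contDiffOn hS hAs (e, 0))
  have hB' := hD (dirD_contDiffOn hS hBs (e, 0))
  have hC' := hD (dirD_contDiffOn hS hCs (e, 0))
  set k := inner ℝ u a
  set l := ‖a‖ ^ 2 with hl
  set d := inner ℝ e u
  set g := inner ℝ e a
  -- This polynomial bounds from below the factor of `μ` supplied by `hessForm_ge_of_sphere` along
  -- the path, and agrees with it to second order at `0`. Replacing `‖z + τ e‖⁻¹` in this way costs
  -- nothing in the second derivative.
  have hP : ∀ τ : ℝ, HasDerivAt
      (fun τ : ℝ => (1 - τ ^ 2 / 2) * (1 + 2 * τ * k + τ ^ 2 * l) - (τ * d + τ ^ 2 * g) ^ 2)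
      (-τ * (1 + 2 * τ * k + τ ^ 2 * l) + (1 - τ ^ 2 / 2) * (2 * k + 2 * τ * l)
        - 2 * (τ * d + τ ^ 2 * g) * (d + 2 * τ * g)) τ := by
    intro τ
    have i1 := hasDerivAt_id τ
    have i2 := i1.pow 2
    have := (((i2.div_const 2).const_sub 1).mul
      ((((i1.const_mul 2).mul_const k).const_add 1).add (i2.mul_const l))).sub
      (((i1.mul_const d).add (i2.mul_const g)).pow 2)
    refine this.congr_deriv ?_
    simp
  have hP' : HasDerivAt
      (fun τ : ℝ => -τ * (1 + 2 * τ * k + τ ^ 2 * l) + (1 - τ ^ 2 / 2) * (2 * k + 2 * τ * l)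
        - 2 * (τ * d + τ ^ 2 * g) * (d + 2 * τ * g)) (2 * l - 1 - 2 * d ^ 2) 0 := by
    have i1 := hasDerivAt_id (0 : ℝ)
    have i2 := i1.pow 2
    have := ((i1.neg.mul ((((i1.const_mul 2).mul_const k).const_add 1).add (i2.mul_const l))).add
      (((i2.div_const 2).const_sub 1).mul (((i1.const_mul 2).mul_const l).const_add (2 * k)))).sub
      ((((i1.mul_const d).add (i2.mul_const g)).const_mul 2).mul
        (((i1.const_mul 2).mul_const g).const_add d))
    refine this.congr_deriv ?_
    simp
    ring
  refine second_deriv_nonneg_of_min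
    (f := fun τ : ℝ => hessForm t₀ s (z + τ • e, t) u u
      + 2 * (τ * hessForm t₀ s (z + τ • e, t) u a)
      + τ ^ 2 * hessForm t₀ s (z + τ • e, t) a a
      - μ * ((1 - τ ^ 2 / 2) * (1 + 2 * τ * k + τ ^ 2 * l) - (τ * d + τ ^ 2 * g) ^ 2))
    (f' := fun τ : ℝ => dirD (slab n t₀) (e, 0) (fun q => hessForm t₀ s q u u) (z + τ • e, t)
      + 2 * (hessForm t₀ s (z + τ • e, t) u a
        + τ * dirD (slab n t₀) (e, 0) (fun q => hessForm t₀ s q u a) (z + τ • e, t))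
      + (2 * τ * hessForm t₀ s (z + τ • e, t) a a
        + τ ^ 2 * dirD (slab n t₀) (e, 0) (fun q => hessForm t₀ s q a a) (z + τ • e, t))
      - μ * (-τ * (1 + 2 * τ * k + τ ^ 2 * l) + (1 - τ ^ 2 / 2) * (2 * k + 2 * τ * l)
        - 2 * (τ * d + τ ^ 2 * g) * (d + 2 * τ * g))) ?_ ?_ ?_ ?_
  · intro τ
    have i1 := hasDerivAt_id τ
    have := (((hA τ).add ((i1.mul (hB τ)).const_mul 2)).add ((i1.pow 2).mul (hC τ))).sub
      ((hP τ).const_mul μ)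
    refine this.congr_deriv ?_
    simp
  · have i1 := hasDerivAt_id (0 : ℝ)
    have := (((hA' 0).add (((hB 0).add (i1.mul (hB' 0))).const_mul 2)).add
      (((i1.const_mul 2).mul (hC 0)).add ((i1.pow 2).mul (hC' 0)))).sub (hP'.const_mul μ)
    refine this.congr_deriv ?_
    simp
    ring
  · simp [hμu]
  · intro τ
    have h1 := hessForm_ge_of_sphere hpos hh ht hmin (hne τ) (u + τ • a)
    have h2 : hessForm t₀ s (z + τ • e, t) (u + τ • a) (u + τ • a) =
        hessForm t₀ s (z + τ • e, t) u u + 2 * (τ * hessForm t₀ s (z + τ • e, t) u a)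
          + τ ^ 2 * hessForm t₀ s (z + τ • e, t) a a := by
      simp only [map_add, map_smul, add_apply, smul_apply, smul_eq_mul]
      rw [hessForm_comm hpos hh (mem_slab.2 ⟨hne τ, ht⟩) a u]
      ring
    have h3 : ‖u + τ • a‖ ^ 2 = 1 + 2 * τ * k + τ ^ 2 * l := by
      rw [norm_add_sq_real, inner_smul_right, norm_smul, hu, Real.norm_eq_abs, mul_pow, sq_abs]
      ring
    have h4 : inner ℝ (z + τ • e) (u + τ • a) = τ * d + τ ^ 2 * g := by
      simp only [inner_add_left, inner_add_right, inner_smul_right, real_inner_smul_left, hzu, hza]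
      ring
    have hr : 0 < ‖z + τ • e‖ := norm_pos_iff.2 (hne τ)
    obtain ⟨b1, b2⟩ := inv_bounds_of_sq_eq hr (norm_sq_add_smul hz he hze τ)
    rw [h2, h3, h4] at h1
    have h5 : 0 ≤ 1 + 2 * τ * k + τ ^ 2 * l := by rw [← h3]; positivity
    have h6 : (1 - τ ^ 2 / 2) * (1 + 2 * τ * k + τ ^ 2 * l) - (τ * d + τ ^ 2 * g) ^ 2 ≤
        ‖z + τ • e‖⁻¹ * (1 + 2 * τ * k + τ ^ 2 * l
          - (‖z + τ • e‖⁻¹ * (τ * d + τ ^ 2 * g)) ^ 2) := by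
      nlinarith [mul_le_mul_of_nonneg_right b1 h5,
        mul_le_mul_of_nonneg_right b2 (sq_nonneg (τ * d + τ ^ 2 * g))]
    have h7 := mul_le_mul_of_nonneg_left h6 hμ
    change 0 ≤ _ - _
    linarith

end MaximumPrinciple

/-! ### Evolution of the Hessian at a minimum -/

section TimeDerivative

variable {n : ℕ} {t₀ : ℝ}

theorem dirD_dirD_dirD_comm {W : Type*} [NormedAddCommGroup W] [NormedSpace ℝ W] {S : Set W}
    (hS : UniqueDiffOn ℝ S) (hcl : S ⊆ closure (interior S)) {f : W → ℝ}
    (hf : ContDiffOn ℝ ∞ f S) (ξ η : W) :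
    Set.EqOn (dirD S ξ (dirD S η (dirD S η f))) (dirD S η (dirD S η (dirD S ξ f))) S :=
  (dirD_comm hS hcl (dirD_contDiffOn hS hf η) ξ η).trans
    (dirD_congr (dirD_comm hS hcl hf ξ η) η)

theorem dirD_hessForm_sum {s : ℝ → Euc n → ℝ} (hpos : 0 < t₀)
    (hh : ContDiffOn ℝ ∞ (homExt s) (slab n t₀)) {x : Euc n} {t : ℝ} (hx : x ≠ 0)
    (ht : t ∈ Set.Icc 0 t₀) {ι : Type*} [Fintype ι] (e u : Euc n) (c : ι → ℝ) (v : ι → Euc n) :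
    dirD (slab n t₀) (e, 0) (fun q => hessForm t₀ s q u (∑ k, c k • v k)) (x, t) =
      ∑ k, c k * dirD (slab n t₀) (e, 0) (fun q => hessForm t₀ s q u (v k)) (x, t) := by
  have hx' : x + (0 : ℝ) • e ≠ 0 := by simpa using hx
  have h1 := hasDerivAt_space (hessForm_contDiffOn hpos hh u (∑ k, c k • v k)) hx' ht
  have h2 := HasDerivAt.fun_sum (u := Finset.univ) fun k _ =>
    (hasDerivAt_space (hessForm_contDiffOn hpos hh u (v k)) hx' ht).const_mul (c k)
  simp only [map_sum, map_smul, smul_eq_mul, zero_smul, add_zero] at h1 h2 ⊢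
  exact h1.unique h2

theorem dirD_time_homExt {s : ℝ → Euc n → ℝ} (hpos : 0 < t₀)
    (hh : ContDiffOn ℝ ∞ (homExt s) (slab n t₀)) {p : ℝ}
    (hflow : ∀ t ∈ Set.Icc 0 t₀, ∀ z : Euc n, ‖z‖ = 1 →
      HasDerivWithinAt (fun τ => s τ z) (speed p (s t) z) (Set.Icc 0 t₀) t)
    {x : Euc n} {t : ℝ} (hx : x ≠ 0) (ht : t ∈ Set.Icc 0 t₀) :
    dirD (slab n t₀) (0, 1) (homExt s) (x, t) = ‖x‖ * speed p (s t) (‖x‖⁻¹ • x) := by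
  have hν1 : ‖‖x‖⁻¹ • x‖ = 1 := by
    rw [norm_smul, norm_inv, norm_norm, inv_mul_cancel₀ (norm_ne_zero_iff.2 hx)]
  exact (uniqueDiffOn_Icc hpos t ht).eq_deriv _ (hasDerivWithinAt_time hh hx ht)
    ((hflow t ht _ hν1).const_mul ‖x‖)

theorem hasDerivAt_log_one_add_sq (τ : ℝ) :
    HasDerivAt (fun τ : ℝ => Real.log (1 + τ ^ 2)) (2 * τ / (1 + τ ^ 2)) τ := by
  have := (((hasDerivAt_id τ).pow 2).const_add 1).log (by simp; positivity)
  refine this.congr_deriv ?_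
  simp

theorem hasDerivAt_deriv_log_one_add_sq :
    HasDerivAt (fun τ : ℝ => 2 * τ / (1 + τ ^ 2)) 2 0 := by
  have := ((hasDerivAt_id (0 : ℝ)).const_mul 2).div (((hasDerivAt_id (0 : ℝ)).pow 2).const_add 1)
    (by simp)
  refine this.congr_deriv ?_
  simp

/-- At a minimum `μ` of the Hessian over unit tangent vectors, a lower bound for the second
logarithmic derivative of the Gauss curvature determinant. -/
theorem trace_second_variation {s : ℝ → Euc n → ℝ} (hpos : 0 < t₀)
    (hh : ContDiffOn ℝ ∞ (homExt s) (slab n t₀)) {t : ℝ} (ht : t ∈ Set.Icc 0 t₀)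
    {μ : ℝ} (hμ : 0 < μ)
    (hmin : ∀ z v : Euc n, ‖z‖ = 1 → inner ℝ z v = 0 →
      μ * ‖v‖ ^ 2 ≤ hessForm t₀ s (z, t) v v)
    {m : ℕ} {z : Euc n} (hz : ‖z‖ = 1) (e : OrthonormalBasis (Fin m) ℝ (sphTangent z))
    {lam : Fin m → ℝ} (hlam : ∀ k l, hessForm t₀ s (z, t) (e k) (e l) = if k = l then lam k else 0)
    {i₀ : Fin m} (hi₀ : lam i₀ = μ) :
    -((m : ℝ) + 2) ≤ ∑ i, (lam i)⁻¹ * dirD (slab n t₀) (e i₀, 0) (dirD (slab n t₀) (e i₀, 0)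
        fun q => hessForm t₀ s q (e i) (e i)) (z, t)
      - ∑ i, ∑ k, (lam i)⁻¹ * (lam k)⁻¹ *
        (dirD (slab n t₀) (e i₀, 0) (fun q => hessForm t₀ s q (e i) (e k)) (z, t) *
          dirD (slab n t₀) (e i₀, 0) (fun q => hessForm t₀ s q (e k) (e i)) (z, t)) := by
  have hS := slab_uniqueDiffOn (n := n) hpos
  have hcl := slab_subset_closure (n := n) hpos
  have hz0 : z ≠ 0 := by rintro rfl; simp at hz
  have hq : (z, t) ∈ slab n t₀ := mem_slab.2 ⟨hz0, ht⟩
  have he1 : ∀ i, ‖(e i : Euc n)‖ = 1 := fun i => by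
    rw [← Submodule.coe_norm]; exact e.orthonormal.1 i
  have hze : ∀ i, inner ℝ z (e i : Euc n) = 0 := fun i =>
    Submodule.mem_orthogonal_singleton_iff_inner_right.1 (e i).2
  have hee : ∀ i k, inner ℝ (e i : Euc n) (e k : Euc n) = if i = k then (1 : ℝ) else 0 :=
    fun i k => by rw [← Submodule.coe_inner, orthonormal_iff_ite.1 e.orthonormal i k]
  have hge : ∀ i, μ ≤ lam i := fun i => by
    have := hmin z (e i) hz (hze i)
    rwa [he1, hlam, if_pos rfl, one_pow, mul_one] at this
  have hlpos : ∀ i, 0 < lam i := fun i => hμ.trans_le (hge i)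
  set M2 : Fin m → ℝ := fun i => dirD (slab n t₀) (e i₀, 0) (dirD (slab n t₀) (e i₀, 0)
        fun q => hessForm t₀ s q (e i) (e i)) (z, t) with hM2
  set T : Fin m → Fin m → ℝ := fun i k =>
    dirD (slab n t₀) (e i₀, 0) (fun q => hessForm t₀ s q (e i) (e k)) (z, t) with hT
  have hTsymm : ∀ i k, T k i = T i k := fun i k =>
    dirD_congr (fun q hq => hessForm_comm hpos hh hq _ _) _ hq
  have happ : ∀ a b : Euc n, Set.EqOn (fun q => hessForm t₀ s q a b)
      (dirD (slab n t₀) (a, 0) (dirD (slab n t₀) (b, 0) (homExt s))) (slab n t₀) :=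
    fun a b q hq => hessForm_apply hpos hh hq a b
  -- Third and fourth derivatives of `homExt s` are symmetric in all their indices, so derivatives
  -- of the `e i₀` entries along `e i` become derivatives of the other entries along `e i₀`.
  have hc1 : ∀ i k, dirD (slab n t₀) (e i, 0)
      (fun q => hessForm t₀ s q (e i₀) (e k)) (z, t) = T i k := by
    intro i k
    simp only [hT]
    rw [dirD_congr (happ _ _) _ hq, dirD_congr (happ _ _) _ hq]
    exact dirD_comm hS hcl (dirD_contDiffOn hS hh _) _ _ hq
  have hc2 : ∀ i, dirD (slab n t₀) (e i, 0) (dirD (slab n t₀) (e i, 0)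
      fun q => hessForm t₀ s q (e i₀) (e i₀)) (z, t) = M2 i := by
    intro i
    rw [hM2, dirD_congr (dirD_congr (happ _ _) _) _ hq]
    simp only
    rw [dirD_congr (dirD_congr (happ _ _) _) _ hq,
      dirD_congr (dirD_dirD_dirD_comm hS hcl hh _ _) _ hq]
    exact dirD_dirD_dirD_comm hS hcl (dirD_contDiffOn hS hh _) _ _ hq
  have key : ∀ i, 2 * ∑ k, (lam k)⁻¹ * T i k ^ 2 - μ - 2 * μ * (if i = i₀ then 1 else 0) ≤ M2 i := by
    intro i
    -- These coefficients minimise `4 ∑ c_k T_ik + 2 ∑ λ_k c_k²`, with minimum `-2 ∑ T_ik² / λ_k`.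
    -- The term `2 μ |a|²` has a favourable sign and is dropped below.
    set c : Fin m → ℝ := fun k => -((lam k)⁻¹ * T i k) with hc
    have hza : inner ℝ z (∑ k, c k • (e k : Euc n)) = 0 := by
      rw [inner_sum]
      exact Finset.sum_eq_zero fun k _ => by rw [inner_smul_right, hze, mul_zero]
    have h1 := second_variation hpos hh ht hμ.le hmin hz (he1 i) (hze i) (he1 i₀) (hze i₀) hza
      (by rw [hlam, if_pos rfl, hi₀])
    rw [hc2, dirD_hessForm_sum hpos hh hz0 ht, hee] at h1
    simp only [hc1] at h1
    have h2 : hessForm t₀ s (z, t) (∑ k, c k • (e k : Euc n)) (∑ k, c k • (e k : Euc n)) =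
        ∑ k, (lam k)⁻¹ * T i k ^ 2 := by
      simp only [map_sum, map_smul, sum_apply, smul_apply, hlam, smul_eq_mul]
      simp only [mul_ite, mul_zero, Finset.sum_ite_eq', Finset.mem_univ, if_true]
      refine Finset.sum_congr rfl fun k _ => ?_
      have := (hlpos k).ne'
      simp only [hc]
      field_simp
    have h3 : ∑ k, c k * T i k = -∑ k, (lam k)⁻¹ * T i k ^ 2 := by
      rw [← Finset.sum_neg_distrib]
      exact Finset.sum_congr rfl fun k _ => by simp only [hc]; ring
    rw [h2, h3] at h1
    have h4 : 0 ≤ μ * ‖∑ k, c k • (e k : Euc n)‖ ^ 2 := by positivity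
    have h5 : (if i = i₀ then (1 : ℝ) else 0) ^ 2 = if i = i₀ then 1 else 0 := by
      split_ifs <;> simp
    rw [h5] at h1
    linarith
  have h1 : ∑ i, (lam i)⁻¹ * (2 * ∑ k, (lam k)⁻¹ * T i k ^ 2 - μ
      - 2 * μ * (if i = i₀ then 1 else 0)) ≤ ∑ i, (lam i)⁻¹ * M2 i :=
    Finset.sum_le_sum fun i _ => mul_le_mul_of_nonneg_left (key i) (inv_nonneg.2 (hlpos i).le)
  have h2 : ∑ i, (lam i)⁻¹ * (2 * ∑ k, (lam k)⁻¹ * T i k ^ 2 - μ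
      - 2 * μ * (if i = i₀ then 1 else 0)) =
      2 * ∑ i, ∑ k, (lam i)⁻¹ * (lam k)⁻¹ * T i k ^ 2 - ∑ i, (lam i)⁻¹ * μ - 2 := by
    simp only [mul_sub, Finset.sum_sub_distrib, Finset.mul_sum]
    congr 1
    · congr 1
      exact Finset.sum_congr rfl fun i _ => Finset.sum_congr rfl fun k _ => by ring
    · simp [hi₀]
      field_simp
  -- Each ratio `μ / λ_i` is at most `1`. Together with the `2` from the index `i₀`, this makes up
  -- the constant `m + 2`.
  have h3 : ∑ i, (lam i)⁻¹ * μ ≤ m := by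
    calc ∑ i, (lam i)⁻¹ * μ ≤ ∑ _i : Fin m, (1 : ℝ) := Finset.sum_le_sum fun i _ => by
          rw [inv_mul_le_iff₀ (hlpos i), mul_one]; exact hge i
      _ = m := by simp
  have h4 : 0 ≤ ∑ i, ∑ k, (lam i)⁻¹ * (lam k)⁻¹ * T i k ^ 2 :=
    Finset.sum_nonneg fun i _ => Finset.sum_nonneg fun k _ =>
      mul_nonneg (mul_nonneg (inv_nonneg.2 (hlpos i).le) (inv_nonneg.2 (hlpos k).le)) (sq_nonneg _)
  have h5 : ∑ i, ∑ k, (lam i)⁻¹ * (lam k)⁻¹ * (T i k * T k i) =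
      ∑ i, ∑ k, (lam i)⁻¹ * (lam k)⁻¹ * T i k ^ 2 :=
    Finset.sum_congr rfl fun i _ => Finset.sum_congr rfl fun k _ => by rw [hTsymm i k]; ring
  rw [h5]
  linarith

/-- At a minimum of the Hessian over unit tangent vectors, its time derivative is at least the
speed. -/
theorem hessForm_time_deriv_ge {m : ℕ} {s : ℝ → Euc (m + 1) → ℝ} (hpos : 0 < t₀)
    (hs : ContDiffOn ℝ ∞ (fun q : Euc (m + 1) × ℝ => radialExt (s q.2) q.1) (slab (m + 1) t₀))
    {p : ℝ} (hp : 0 < p) {t : ℝ} (ht : t ∈ Set.Icc 0 t₀)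
    (hflow : ∀ t ∈ Set.Icc 0 t₀, ∀ z : Euc (m + 1), ‖z‖ = 1 →
      HasDerivWithinAt (fun τ => s τ z) (speed p (s t) z) (Set.Icc 0 t₀) t)
    {μ : ℝ} (hμ : 0 < μ)
    (hmin : ∀ z v : Euc (m + 1), ‖z‖ = 1 → inner ℝ z v = 0 →
      μ * ‖v‖ ^ 2 ≤ hessForm t₀ s (z, t) v v)
    {z : Euc (m + 1)} (hz : ‖z‖ = 1) (e : OrthonormalBasis (Fin m) ℝ (sphTangent z))
    {lam : Fin m → ℝ} (hlam : ∀ k l, hessForm t₀ s (z, t) (e k) (e l) = if k = l then lam k else 0)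
    {i₀ : Fin m} (hi₀ : lam i₀ = μ) :
    speed p (s t) z ≤
      dirD (slab (m + 1) t₀) (0, 1) (fun q => hessForm t₀ s q (e i₀) (e i₀)) (z, t) := by
  have hh := homExt_contDiffOn hs
  have hS := slab_uniqueDiffOn (n := m + 1) hpos
  have hcl := slab_subset_closure (n := m + 1) hpos
  have hz0 : z ≠ 0 := by rintro rfl; simp at hz
  have hq : (z, t) ∈ slab (m + 1) t₀ := mem_slab.2 ⟨hz0, ht⟩
  have he1 : ∀ i, ‖(e i : Euc (m + 1))‖ = 1 := fun i => by
    rw [← Submodule.coe_norm]; exact e.orthonormal.1 i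
  have hze : ∀ i, inner ℝ z (e i : Euc (m + 1)) = 0 := fun i =>
    Submodule.mem_orthogonal_singleton_iff_inner_right.1 (e i).2
  have hlpos : ∀ i, 0 < lam i := fun i => by
    have := hmin z (e i) hz (hze i)
    rw [he1, hlam, if_pos rfl, one_pow, mul_one] at this
    exact hμ.trans_le this
  set u : Euc (m + 1) := (e i₀ : Euc (m + 1)) with hu
  have hu1 : ‖u‖ = 1 := he1 i₀
  have hzu : inner ℝ z u = 0 := hze i₀
  have hne := add_smul_ne_zero hz hzu
  have hD : ∀ {f : Euc (m + 1) × ℝ → ℝ}, ContDiffOn ℝ ∞ f (slab (m + 1) t₀) → ∀ τ : ℝ,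
      HasDerivAt (fun τ : ℝ => f (z + τ • u, t))
        (dirD (slab (m + 1) t₀) (u, 0) f (z + τ • u, t)) τ :=
    fun hf τ => hasDerivAt_space hf (hne τ) ht
  have happ : Set.EqOn (fun q => hessForm t₀ s q u u)
      (dirD (slab (m + 1) t₀) (u, 0) (dirD (slab (m + 1) t₀) (u, 0) (homExt s)))
      (slab (m + 1) t₀) :=
    fun q hq => hessForm_apply hpos hh hq u u
  -- Exchanging `∂_t` with the two spatial derivatives turns the goal into `F ≤ G_uu`, where `G =
  -- ∂_t h`.
  rw [dirD_congr happ _ hq, dirD_dirD_dirD_comm hS hcl hh _ _ hq]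
  set G := dirD (slab (m + 1) t₀) (0, 1) (homExt s)
  have hG : ContDiffOn ℝ ∞ G (slab (m + 1) t₀) := dirD_contDiffOn hS hh _
  have hGval : ∀ x : Euc (m + 1), x ≠ 0 → G (x, t) = ‖x‖ * speed p (s t) (‖x‖⁻¹ • x) :=
    fun x hx => dirD_time_homExt hpos hh hflow hx ht
  set α : ℝ := p / (((m + 1 : ℕ) : ℝ) - 1) with hα
  have hα0 : 0 ≤ α := div_nonneg hp.le (by push_cast; simp)
  let M : ℝ → Matrix (Fin m) (Fin m) ℝ := fun τ =>
    Matrix.of fun k l => hessForm t₀ s (z + τ • u, t) (e k) (e l)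
  let M' : ℝ → Matrix (Fin m) (Fin m) ℝ := fun τ => Matrix.of fun k l =>
    dirD (slab (m + 1) t₀) (u, 0) (fun q => hessForm t₀ s q (e k) (e l)) (z + τ • u, t)
  let M'' : Matrix (Fin m) (Fin m) ℝ := Matrix.of fun k l =>
    dirD (slab (m + 1) t₀) (u, 0) (dirD (slab (m + 1) t₀) (u, 0)
      fun q => hessForm t₀ s q (e k) (e l)) (z + (0 : ℝ) • u, t)
  have hMd : ∀ τ i j, HasDerivAt (fun τ => M τ i j) (M' τ i j) τ := fun τ i j =>
    hD (hessForm_contDiffOn hpos hh _ _) τ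
  have hM'd : ∀ i j, HasDerivAt (fun τ => M' τ i j) (M'' i j) 0 := fun i j =>
    hD (dirD_contDiffOn hS (hessForm_contDiffOn hpos hh _ _) _) 0
  have hM0 : M 0 = Matrix.diagonal lam := by
    ext k l
    simp [M, hlam, Matrix.diagonal_apply]
  obtain ⟨L', hL', hL''⟩ := log_det_second_deriv hMd hM'd hM0 hlpos
  have hdet0 : 0 < (M 0).det := by
    rw [hM0, Matrix.det_diagonal]; exact Finset.prod_pos fun i _ => hlpos i
  have hdet : ∀ᶠ τ in 𝓝 (0 : ℝ), 0 < (M τ).det :=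
    (hasDerivAt_det (hMd 0)).continuousAt.eventually (lt_mem_nhds hdet0)
  have hgL : ∀ᶠ τ in 𝓝 (0 : ℝ), G (z + τ • u, t) =
      Real.exp ((1 / 2 + α * (m + 2) / 2) * Real.log (1 + τ ^ 2) + α * Real.log (M τ).det) := by
    filter_upwards [hdet] with τ hτ
    have hr : 0 < ‖z + τ • u‖ := norm_pos_iff.2 (hne τ)
    have hlog : Real.log (1 + τ ^ 2) = 2 * Real.log ‖z + τ • u‖ := by
      rw [← norm_sq_add_smul hz hu1 hzu, Real.log_pow]; norm_num
    rw [hGval _ (hne τ)]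
    unfold speed
    rw [det_hessForm hpos hs ht hz e (inner_add_smul_self hz hzu τ), ← hα,
      Real.rpow_def_of_pos (mul_pos (pow_pos hr _) hτ), Real.log_mul (pow_pos hr _).ne' hτ.ne',
      Real.log_pow, hlog]
    nth_rewrite 1 [← Real.exp_log hr]
    rw [← Real.exp_add]
    congr 1
    push_cast
    ring
  have hLd : ∀ᶠ τ in 𝓝 (0 : ℝ), HasDerivAt (fun τ : ℝ =>
      (1 / 2 + α * (m + 2) / 2) * Real.log (1 + τ ^ 2) + α * Real.log (M τ).det)
      ((1 / 2 + α * (m + 2) / 2) * (2 * τ / (1 + τ ^ 2)) + α * L' τ) τ := by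
    filter_upwards [hL'] with τ hτ
    exact ((hasDerivAt_log_one_add_sq τ).const_mul _).add (hτ.const_mul α)
  have h1 := exp_second_deriv_ge hLd
    ((hasDerivAt_deriv_log_one_add_sq.const_mul (1 / 2 + α * (m + 2) / 2)).add (hL''.const_mul α))
    (hD hG) (hD (dirD_contDiffOn hS hG _) 0) hgL
  have h2 := trace_second_variation hpos hh ht hμ hmin hz e hlam hi₀
  have hGpos : 0 < G (z, t) := by
    have := hgL.self_of_nhds
    rw [zero_smul, add_zero] at this
    rw [this]; exact Real.exp_pos _
  have hGz : G (z, t) = speed p (s t) z := by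
    rw [hGval z hz0, hz]; simp
  simp only [M', M'', Matrix.of_apply, zero_smul, add_zero] at h1
  rw [← hGz]
  refine le_trans ?_ h1
  -- The second derivative of `log G` is `1 + α (m + 2)` from the powers of the norm plus at least
  -- `-α (m + 2)` from the determinant, hence at least `1`.
  refine le_mul_of_one_le_right hGpos.le ?_
  have h3 := mul_le_mul_of_nonneg_left h2 hα0
  linarith

end TimeDerivative

/-! ### Linear growth of the radii of curvature -/

section LowerBound

/-- One-sided necessary first-order condition at a minimum. -/
theorem left_deriv_nonpos_of_min {f : ℝ → ℝ} {f' a t b : ℝ} (hat : a < t) (htb : t ≤ b)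
    (hf : HasDerivWithinAt f f' (Set.Icc a b) t) (hmin : ∀ τ ∈ Set.Icc a b, f t ≤ f τ) :
    f' ≤ 0 := by
  have h1 : HasDerivWithinAt f f' (Set.Ioo a t) t :=
    hf.mono fun τ hτ => ⟨hτ.1.le, hτ.2.le.trans htb⟩
  rw [hasDerivWithinAt_iff_tendsto_slope' (by simp)] at h1
  have hne : (𝓝[Set.Ioo a t] t).NeBot := by
    rw [nhdsWithin_Ioo_eq_nhdsLT hat]; infer_instance
  refine le_of_tendsto h1 ?_
  filter_upwards [self_mem_nhdsWithin] with τ hτ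
  rw [slope_def_field]
  exact div_nonpos_of_nonneg_of_nonpos (sub_nonneg.2 (hmin τ ⟨hτ.1.le, hτ.2.le.trans htb⟩))
    (by linarith [hτ.2])

variable {m : ℕ} {t₀ : ℝ} {s : ℝ → Euc (m + 1) → ℝ}

/-- An orthonormal frame of eigenvectors of the radii of curvature. -/
theorem exists_eigenframe (hpos : 0 < t₀)
    (hs : ContDiffOn ℝ ∞ (fun q : Euc (m + 1) × ℝ => radialExt (s q.2) q.1) (slab (m + 1) t₀))
    {t : ℝ} (ht : t ∈ Set.Icc 0 t₀) {z : Euc (m + 1)} (hz : ‖z‖ = 1) :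
    ∃ (e : OrthonormalBasis (Fin m) ℝ (sphTangent z)) (lam : Fin m → ℝ),
      (∀ k, radii (s t) z (e k) = lam k • e k) ∧
      ∀ k l, hessForm t₀ s (z, t) (e k) (e l) = if k = l then lam k else 0 := by
  have hz0 : z ≠ 0 := by rintro rfl; simp at hz
  have hT : (radii (s t) z).IsSymmetric := fun v w => by
    rw [inner_radii hpos hs ht hz, real_inner_comm, inner_radii hpos hs ht hz,
      hessForm_comm hpos (homExt_contDiffOn hs) (mem_slab.2 ⟨hz0, ht⟩)]
  have hn := finrank_sphTangent hz
  have happ : ∀ k, radii (s t) z (hT.eigenvectorBasis hn k) =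
      hT.eigenvalues hn k • hT.eigenvectorBasis hn k := fun k => by
    simp
  refine ⟨hT.eigenvectorBasis hn, hT.eigenvalues hn, happ, fun k l => ?_⟩
  rw [← inner_radii hpos hs ht hz, happ, real_inner_smul_left,
    orthonormal_iff_ite.1 (hT.eigenvectorBasis hn).orthonormal k l]
  simp

/-- The value at a unit tangent vector is a convex combination of the `lam i`. If none of them is
below it, one of them must equal it. -/
theorem exists_eigenvalue_eq_min {t : ℝ} {z v : Euc (m + 1)} (hz : ‖z‖ = 1)
    (e : OrthonormalBasis (Fin m) ℝ (sphTangent z)) {lam : Fin m → ℝ}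
    (hlam : ∀ k l, hessForm t₀ s (z, t) (e k) (e l) = if k = l then lam k else 0)
    (hv : ‖v‖ = 1) (hzv : inner ℝ z v = 0) (hge : ∀ i, hessForm t₀ s (z, t) v v ≤ lam i) :
    ∃ i, lam i = hessForm t₀ s (z, t) v v := by
  by_contra! hne
  have hexp := frame_decomp hz e v
  rw [hzv, zero_smul, add_zero] at hexp
  have h1 : hessForm t₀ s (z, t) v v = ∑ i, inner ℝ (e i : Euc (m + 1)) v ^ 2 * lam i := by
    conv_lhs => rw [hexp]
    simp only [map_sum, map_smul, sum_apply, smul_apply, hlam, smul_eq_mul]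
    simp only [mul_ite, mul_zero, Finset.sum_ite_eq', Finset.mem_univ, if_true]
    exact Finset.sum_congr rfl fun k _ => by ring
  set μ := hessForm t₀ s (z, t) v v
  have h2 : ∑ i, inner ℝ (e i : Euc (m + 1)) v ^ 2 = 1 := by
    have := inner_frame_decomp hz e v v
    rw [real_inner_self_eq_norm_sq, hv, hzv] at this
    simp only [pow_two]
    linarith
  have h3 : ∑ i, inner ℝ (e i : Euc (m + 1)) v ^ 2 * (lam i - μ) = 0 := by
    simp only [mul_sub, Finset.sum_sub_distrib, ← Finset.sum_mul, h2]
    linarith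
  rw [Finset.sum_eq_zero_iff_of_nonneg fun i _ =>
    mul_nonneg (sq_nonneg _) (sub_nonneg.2 (hge i))] at h3
  have h4 : ∑ i, inner ℝ (e i : Euc (m + 1)) v ^ 2 = 0 := Finset.sum_eq_zero fun i hi =>
    (mul_eq_zero.1 (h3 i hi)).resolve_right (sub_ne_zero.2 (hne i))
  linarith

theorem mul_sq_norm_le_hessForm {t μ : ℝ} {z : Euc (m + 1)}
    (h : ∀ v : Euc (m + 1), ‖v‖ = 1 → inner ℝ z v = 0 → μ ≤ hessForm t₀ s (z, t) v v)
    {v : Euc (m + 1)} (hzv : inner ℝ z v = 0) : μ * ‖v‖ ^ 2 ≤ hessForm t₀ s (z, t) v v := by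
  rcases eq_or_ne v 0 with rfl | hv0
  · simp
  have hvn : 0 < ‖v‖ := norm_pos_iff.2 hv0
  have h1 := h (‖v‖⁻¹ • v)
    (by rw [norm_smul, norm_inv, norm_norm, inv_mul_cancel₀ hvn.ne'])
    (by rw [inner_smul_right, hzv, mul_zero])
  simp only [map_smul, smul_apply, smul_eq_mul] at h1
  calc μ * ‖v‖ ^ 2 ≤ (‖v‖⁻¹ * (‖v‖⁻¹ * hessForm t₀ s (z, t) v v)) * ‖v‖ ^ 2 :=
        mul_le_mul_of_nonneg_right h1 (sq_nonneg _)
    _ = _ := by field_simp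

/-- The maximum principle: the radii of curvature grow at least linearly in time. -/
theorem mul_le_hessForm (hpos : 0 < t₀)
    (hs : ContDiffOn ℝ ∞ (fun q : Euc (m + 1) × ℝ => radialExt (s q.2) q.1) (slab (m + 1) t₀))
    {p : ℝ} (hp : 0 < p)
    (hflow : ∀ t ∈ Set.Icc 0 t₀, ∀ z : Euc (m + 1), ‖z‖ = 1 →
      HasDerivWithinAt (fun τ => s τ z) (speed p (s t) z) (Set.Icc 0 t₀) t)
    (hconv : ∀ t ∈ Set.Icc 0 t₀, ∀ z : Euc (m + 1), ‖z‖ = 1 → ∀ v : sphTangent z, v ≠ 0 →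
      0 < inner ℝ (radii (s t) z v) v)
    {C₁ : ℝ} (hC₁ : ∀ t ∈ Set.Icc 0 t₀, ∀ z : Euc (m + 1), ‖z‖ = 1 → C₁ ≤ speed p (s t) z)
    {t : ℝ} (ht : t ∈ Set.Icc 0 t₀) {z v : Euc (m + 1)} (hz : ‖z‖ = 1) (hv : ‖v‖ = 1)
    (hzv : inner ℝ z v = 0) :
    C₁ * t ≤ hessForm t₀ s (z, t) v v := by
  have hh := homExt_contDiffOn hs
  have hposH : ∀ t ∈ Set.Icc 0 t₀, ∀ z v : Euc (m + 1), ‖z‖ = 1 → ‖v‖ = 1 → inner ℝ z v = 0 →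
      0 < hessForm t₀ s (z, t) v v := by
    intro t ht z v hz hv hzv
    have hmem : v ∈ sphTangent z := Submodule.mem_orthogonal_singleton_iff_inner_right.2 hzv
    rw [← inner_radii hpos hs ht hz ⟨v, hmem⟩ ⟨v, hmem⟩]
    refine hconv t ht z hz _ fun h => ?_
    have : v = 0 := congrArg Subtype.val h
    rw [this] at hv; simp at hv
  by_contra! hlt
  have ht0 : 0 < t := by
    refine lt_of_le_of_ne ht.1 fun h => ?_
    have := hposH t ht z v hz hv hzv
    rw [← h] at hlt this
    linarith
  -- A slope strictly below `C₁` leaves room for a contradiction at the minimum, while `H - c t` is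
  -- still negative at the given point, where `H` is the Hessian value.
  obtain ⟨c, hc1, hc2⟩ := exists_between ((div_lt_iff₀ ht0).2 hlt)
  rw [div_lt_iff₀ ht0] at hc1
  let A : Set ((Euc (m + 1) × ℝ) × Euc (m + 1)) :=
    {r | inner ℝ r.1.1 r.2 = 0} ∩
      ((Metric.sphere 0 1 ×ˢ Set.Icc 0 t₀) ×ˢ Metric.sphere 0 1)
  have hAc : IsCompact A :=
    ((((isCompact_sphere 0 1).prod isCompact_Icc).prod (isCompact_sphere 0 1))).inter_left
      (isClosed_eq (by fun_prop) continuous_const)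
  have hmemA : ∀ {z v : Euc (m + 1)} {t : ℝ}, ((z, t), v) ∈ A ↔
      inner ℝ z v = 0 ∧ (‖z‖ = 1 ∧ t ∈ Set.Icc 0 t₀) ∧ ‖v‖ = 1 := by
    intro z v t; simp [A]
  have hcont : ContinuousOn (fun r : (Euc (m + 1) × ℝ) × Euc (m + 1) =>
      hessForm t₀ s r.1 r.2 r.2 - c * r.1.2) A := by
    refine ((hessForm_continuousOn hpos hh).mono ?_).sub (by fun_prop)
    rintro ⟨⟨z, t⟩, v⟩ hr
    obtain ⟨-, ⟨h1, h2⟩, -⟩ := hmemA.1 hr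
    exact ⟨mem_slab.2 ⟨by rintro rfl; simp at h1, h2⟩, trivial⟩
  have h0A : ((z, t), v) ∈ A := hmemA.2 ⟨hzv, ⟨hz, ht⟩, hv⟩
  obtain ⟨⟨⟨z₁, t₁⟩, v₁⟩, hr₁, hmin₁⟩ := hAc.exists_isMinOn ⟨_, h0A⟩ hcont
  obtain ⟨hzv₁, ⟨hz₁, ht₁⟩, hv₁⟩ := hmemA.1 hr₁
  have hmin : ∀ {z v : Euc (m + 1)} {t : ℝ}, ‖z‖ = 1 → t ∈ Set.Icc 0 t₀ → ‖v‖ = 1 →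
      inner ℝ z v = 0 → hessForm t₀ s (z₁, t₁) v₁ v₁ - c * t₁ ≤
        hessForm t₀ s (z, t) v v - c * t := by
    intro z v t hz ht hv hzv
    have h1 : ((z, t), v) ∈ A := hmemA.2 ⟨hzv, ⟨hz, ht⟩, hv⟩
    exact isMinOn_iff.1 hmin₁ ((z, t), v) h1
  set μ := hessForm t₀ s (z₁, t₁) v₁ v₁ with hμ
  have hμpos : 0 < μ := hposH t₁ ht₁ z₁ v₁ hz₁ hv₁ hzv₁
  have hneg := hmin hz ht hv hzv
  -- At time `0` the function equals `H > 0` by strict convexity, whereas its minimum is negative.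
  have ht₁pos : 0 < t₁ := by
    refine lt_of_le_of_ne ht₁.1 fun h => ?_
    rw [← h] at hneg
    linarith
  have hsph : ∀ z v : Euc (m + 1), ‖z‖ = 1 → inner ℝ z v = 0 →
      μ * ‖v‖ ^ 2 ≤ hessForm t₀ s (z, t₁) v v := by
    exact fun z v hz hzv => mul_sq_norm_le_hessForm (fun w hw hzw => by
      linarith [hmin hz ht₁ hw hzw]) hzv
  obtain ⟨e, lam, -, hlam⟩ := exists_eigenframe hpos hs ht₁ hz₁
  have he1 : ∀ i, ‖(e i : Euc (m + 1))‖ = 1 := fun i => by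
    rw [← Submodule.coe_norm]; exact e.orthonormal.1 i
  have hze : ∀ i, inner ℝ z₁ (e i : Euc (m + 1)) = 0 := fun i =>
    Submodule.mem_orthogonal_singleton_iff_inner_right.1 (e i).2
  have hge : ∀ i, μ ≤ lam i := fun i => by
    have := hsph z₁ (e i) hz₁ (hze i)
    rwa [he1, hlam, if_pos rfl, one_pow, mul_one] at this
  obtain ⟨i₀, hi₀⟩ := exists_eigenvalue_eq_min hz₁ e hlam hv₁ hzv₁ hge
  have hz₁0 : z₁ ≠ 0 := by rintro rfl; simp at hz₁
  have hderiv := hessForm_time_deriv_ge hpos hs hp ht₁ hflow hμpos hsph hz₁ e hlam hi₀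
  have ht' := (hasDerivWithinAt_time (hessForm_contDiffOn hpos hh (e i₀) (e i₀)) hz₁0 ht₁).sub
    ((hasDerivWithinAt_id t₁ _).const_mul c)
  have hval : hessForm t₀ s (z₁, t₁) (e i₀) (e i₀) = μ := by rw [hlam, if_pos rfl, hi₀]
  -- The eigenvector `e i₀` attains the same minimum and is kept fixed in time. Minimality against
  -- earlier times gives `∂_t H ≤ c`, while `∂_t H ≥ F ≥ C₁ > c`.
  have hfin := left_deriv_nonpos_of_min ht₁pos ht₁.2 ht' fun τ hτ => by
    have h1 := hmin hz₁ hτ (he1 i₀) (hze i₀)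
    rw [← hval] at h1
    exact h1
  linarith [hC₁ t₁ ht₁ z₁ hz₁]

end LowerBound

/-! ### Curvature bounds -/

theorem lemma4p5 (C₁ C₂ : ℝ) (hC₁ : 0 < C₁) :
    ∃ C : ℝ, 0 < C ∧
      ∀ (n : ℕ) (_ : 2 < n) (p : ℝ) (_ : 0 < p) (_ : p < 1),
        ∃ C' : ℝ, 0 < C' ∧
          ∀ (t₀ : ℝ) (K : ℝ → ConvexBody (Euc n)),
            IsSmoothStrictlyConvexSolution p t₀ K →
            (∀ t ∈ Set.Icc 0 t₀, ∀ z : Euc n, ‖z‖ = 1 →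
              C₁ ≤ speed p (supportFun (K t)) z ∧ speed p (supportFun (K t)) z ≤ C₂) →
            ∀ t ∈ Set.Icc 0 t₀, ∀ z : Euc n, ‖z‖ = 1 →
              ∀ κ : ℝ, IsPrincipalCurvature (supportFun (K t)) z κ →
                C' * t ^ (n - 2) ≤ κ ∧ (0 < t → κ ≤ C / t) := by
  refine ⟨1 / C₁, by positivity, fun n hn p hp _ => ?_⟩
  obtain ⟨m, rfl⟩ : ∃ m, n = m + 1 := ⟨n - 1, by omega⟩
  have hm : (0 : ℝ) < m := by exact_mod_cast (by omega : 0 < m)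
  -- Inverting `F = det ^ (p / m) ≤ C₂` bounds the determinant. The maximum with `C₁` keeps `D`
  -- positive, as nothing is assumed on the sign of `C₂`.
  set D : ℝ := max C₁ C₂ ^ ((m : ℝ) / p) with hDdef
  have hD : 0 < D := Real.rpow_pos_of_pos (lt_max_of_lt_left hC₁) _
  refine ⟨C₁ ^ (m - 1) / D, by positivity, fun t₀ K hK hF t ht z hz κ hκ => ?_⟩
  obtain ⟨ρ, hρ, rfl⟩ := hκ
  obtain ⟨v, hv⟩ := hρ.exists_hasEigenvector
  have hv0 : v ≠ 0 := hv.2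
  have hρv : radii (supportFun (K t)) z v = ρ • v := hv.apply_eq_smul
  have hρpos : 0 < ρ := by
    have h1 := hK.strictly_convex t ht z hz v hv0
    rw [hρv, real_inner_smul_left] at h1
    exact pos_of_mul_pos_left h1 real_inner_self_nonneg
  have hexp : m + 1 - 2 = m - 1 := by omega
  rw [hexp]
  rcases ht.1.eq_or_lt with h0 | htpos
  -- At `t = 0` the exponent `m - 1` is positive because `n > 2`, so the lower bound reduces to `0 ≤
  -- κ`.
  · rw [← h0, zero_pow (by omega)]
    exact ⟨by rw [mul_zero]; positivity, fun h => absurd h (lt_irrefl _)⟩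
  have hpos : 0 < t₀ := htpos.trans_le ht.2
  have hs : ContDiffOn ℝ ∞ (fun q : Euc (m + 1) × ℝ => radialExt (supportFun (K q.2)) q.1)
      (slab (m + 1) t₀) := hK.smooth
  obtain ⟨e, lam, happ, hlam⟩ :=
    exists_eigenframe (s := fun t => supportFun (K t)) hpos hs ht hz
  have hge : ∀ k, C₁ * t ≤ lam k := fun k => by
    have h1 := mul_le_hessForm (s := fun t => supportFun (K t)) hpos hs hp hK.flow
      hK.strictly_convex (fun t ht z hz => (hF t ht z hz).1) ht hz (v := (e k : Euc (m + 1)))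
      (by rw [← Submodule.coe_norm]; exact e.orthonormal.1 k)
      (Submodule.mem_orthogonal_singleton_iff_inner_right.1 (e k).2)
    rwa [hlam, if_pos rfl] at h1
  have hC₁t : 0 < C₁ * t := mul_pos hC₁ htpos
  have hlpos : ∀ k, 0 < lam k := fun k => hC₁t.trans_le (hge k)
  -- By symmetry, `λ_k ⟨e_k, v⟩ = ρ ⟨e_k, v⟩` for every `k`; were `ρ` none of the `λ_k`, all
  -- coordinates of `v` would vanish.
  obtain ⟨j, hj⟩ : ∃ j, lam j = ρ := by
    by_contra! hne
    refine hv0 (e.repr.injective (PiLp.ext fun k => ?_))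
    have hz0 : z ≠ 0 := by rintro rfl; simp at hz
    have h1 : inner ℝ (radii (supportFun (K t)) z (e k)) v =
        inner ℝ (radii (supportFun (K t)) z v) (e k) := by
      rw [inner_radii (s := fun t => supportFun (K t)) hpos hs ht hz,
        inner_radii (s := fun t => supportFun (K t)) hpos hs ht hz,
        hessForm_comm hpos (homExt_contDiffOn hs) (mem_slab.2 ⟨hz0, ht⟩)]
    rw [happ, hρv, real_inner_smul_left, real_inner_smul_left, real_inner_comm (e k) v] at h1
    rw [map_zero, PiLp.zero_apply, e.repr_apply_apply]
    by_contra h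
    exact hne k (mul_right_cancel₀ h h1)
  have hdet : invGauss (supportFun (K t)) z = ∏ k, lam k := by
    have h1 := det_hessForm (s := fun t => supportFun (K t)) hpos hs ht hz e (x := z)
      (by rw [real_inner_self_eq_norm_sq, hz]; norm_num)
    have h2 : (Matrix.of fun k l => hessForm t₀ (fun t => supportFun (K t)) (z, t) (e k) (e l)) =
        Matrix.diagonal lam := by
      ext k l; simp [hlam, Matrix.diagonal_apply]
    rw [h2, Matrix.det_diagonal, hz] at h1
    simpa using h1
  have hdetle : ∏ k, lam k ≤ D := by
    have hprod : 0 < ∏ k, lam k := Finset.prod_pos fun k _ => hlpos k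
    have h1 := (hF t ht z hz).2
    unfold speed at h1
    rw [hdet] at h1
    have h2 : ((m + 1 : ℕ) : ℝ) - 1 = m := by push_cast; ring
    rw [h2] at h1
    calc ∏ k, lam k = ((∏ k, lam k) ^ (p / m)) ^ (m / p) := by
          rw [← Real.rpow_mul hprod.le, div_mul_div_cancel₀ hm.ne', div_self hp.ne', Real.rpow_one]
      _ ≤ D := Real.rpow_le_rpow (Real.rpow_nonneg hprod.le _) (h1.trans (le_max_right _ _))
          (by positivity)
  refine ⟨?_, fun _ => ?_⟩
  · have h1 : (C₁ * t) ^ (m - 1) * ρ ≤ D := by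
      refine le_trans ?_ hdetle
      rw [← Finset.mul_prod_erase _ _ (Finset.mem_univ j), hj, mul_comm]
      refine mul_le_mul_of_nonneg_left ?_ hρpos.le
      have h2 := Finset.prod_le_prod (s := Finset.univ.erase j) (f := fun _ => C₁ * t) (g := lam)
        (fun _ _ => hC₁t.le) fun k _ => hge k
      rwa [Finset.prod_const, Finset.card_erase_of_mem (Finset.mem_univ j), Finset.card_univ,
        Fintype.card_fin] at h2
    rw [le_div_iff₀ hρpos, div_mul_eq_mul_div, div_mul_eq_mul_div, div_le_one hD, ← mul_pow]
    exact h1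
  · rw [div_div]
    exact one_div_le_one_div_of_le hC₁t (hj ▸ hge j)
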